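/- Let $n\ge 0$. Let $(Mb_n)_1=Mb_{n,0}\sqcup Mb_{n,1}$ be the set of crossingless connections (up to isotopy fixing the boundary, without closed components) between $2n$ marked points $x_1,\dots,x_{2n}$ on the boundary of the Möbius band in which no arc ($Mb_{n,0}$) or exactly one arc ($Mb_{n,1}$) intersects the crosscap, once. Let $B_{n,0}$ be the set of crossingless connections between $2n$ marked points on the outer boundary of an annulus, without closed components. Let $B_{n,1}$ be the set of crossingless connections in the annulus with $2n$ outer marked points $x_1,\dots,x_{2n}$ and two inner marked points $y_1,y_2$ in which $n-1$ arcs join outer points, and the two remaining arcs each join an inner to an outer point and are disjoint from the lollipop, that is, from a fixed segment which joins a point of the outer boundary between $x_{2n}$ and $x_1$ to a point of the inner boundary between $y_2$ and $y_1$. Put $(B_n)_1=B_{n,0}\sqcup B_{n,1}$. For $m,m'\in (Mb_n)_1$ glue $m$ to the inversion of $m'$ along the boundary, respecting the marked points. This gives disjoint simple closed curves in the Klein bottle, and $\langle m,m'\rangle_{Mb}\in\mathbb Z[d,x,y,z,w]$ is the product of their labels: $d$ for a null homotopic curve, $x$ and $y$ for a curve homotopic to the core of the first and of the second crosscap, $z$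 for a curve homotopic to the common boundary of the two Möbius bands, and $w$ for a curve homotopic to the simple closed curve that passes once through each crosscap. For $b,b'\in (B_n)_1$ glue $b$ to the inversion of $b'$ along the outer boundary, respecting the marked points. This gives disjoint simple closed curves and arcs in an annulus, whose inner boundary is that of $b$ and whose outer boundary is that of the inverted $b'$. Let $\langle b,b'\rangle_{B}\in\mathbb Z[d,x,y,z,w]$ be the product of the following labels: $d$ for each null homotopic closed curve, $z$ for each other closed curve, $x$ for each arc with both ends on the inner boundary, $y$ for each arc with both ends on the outer boundary, and $w$ for each pair of arcs that join the two boundary components. For every $m\in Mb_{n,0}$ (respectively $m\in Mb_{n,1}$) there is exactly one $\varphi(m)\in B_{n,0}$ (respectively $\varphi(m)\in B_{n,1}$) that is obtained from $m$ by replacing the crosscap by an inner boundary, that is, whose arcs disjoint from the inner boundary are the arcs of $m$ disjoint from the crosscap. The map $\varphi:(Mb_n)_1\to(B_n)_1$ is a bijection, and $\langle\varphi(m),\varphi(m')\rangle_B=\langle m,m'\rangle_{Mb}$ for all $m,m'\in(Mb_n)_1$. Consequently $$\det\big(\langle m,m'\rangle_{Mb}\big)_{m,m'\in(Mb_n)_1}=\det\big(\langle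 b,b'\rangle_{B}\big)_{b,b'\in(B_n)_1}.$$ -/

import Mathlib

/-!
# Crossingless connections on the annulus and on the Möbius band, and their Gram determinants

A crossingless connection (without closed components) between marked points on the boundary of an
annulus or of a Möbius band is recorded, up to isotopy fixing the boundary, by its preimage in the
universal cover of the surface. In both cases the universal cover is an infinite strip
`ℝ × [-1, 1]`, the deck group is `ℤ`, and the preimage is a system of pairwise disjoint arcs that is
invariant under the deck group. Such a system is determined by which lifts of marked points are
joined, and disjoint arcs with given ends exist exactly when no two pairs of ends are interleaved
on the boundary of the strip.

If `L` is the set of marked points, then the lifts of marked points are the pairs `(k, l) : ℤ × L`,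
where `(k, l)` is the translate of `(0, l)` by the `k`-th power of the generator of the deck group.
The marked points on one boundary circle are numbered in the positive direction, starting at a
fixed base point of the circle that is not marked.
-/

namespace SurfaceGram

/-- Positions on the boundary of the strip: the side (`0` is the first side, `1` is the second),
then the place on this side. Travelling once around the strip, one meets the positions in the
lexicographic order. -/
abbrev StripBoundary : Type := ℤ ×ₗ (ℤ ×ₗ ℤ)

/-- A crossingless connection between the marked points `L`, where `pos` is the position of the
lifts of marked points on the boundary of the universal cover: a matching of these lifts that is
invariant under deck transformations and has no two interleaved pairs. -/
@[ext]
structure Connection {L : Type} (pos : ℤ × L → StripBoundary) where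
  /-- the other end of the lifted arc that ends at a given lift of a marked point -/
  mate : ℤ × L → ℤ × L
  mate_ne : ∀ p, mate p ≠ p
  mate_mate : ∀ p, mate (mate p) = p
  mate_deck : ∀ (k : ℤ) (l : L), mate (k + 1, l) = ((mate (k, l)).1 + 1, (mate (k, l)).2)
  noncrossing : ∀ p q, ¬ (pos p < pos q ∧ pos q < pos (mate p) ∧ pos (mate p) < pos (mate q))

/-! ### The annulus -/

/-- The annulus has the outer marked points `Sum.inl 0, …, Sum.inl (m - 1)` and the inner marked
points `Sum.inr 0, …, Sum.inr (p - 1)`. The deck group acts by horizontal translation, the outer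
boundary is covered by the first side of the strip, and the inner one by the second side, which is
passed in the negative direction when one travels around the strip. -/
def annPos (m p : ℕ) : ℤ × (Fin m ⊕ Fin p) → StripBoundary
  | (k, Sum.inl l) => toLex (0, toLex (k, (l : ℤ)))
  | (k, Sum.inr j) => toLex (1, toLex (-k, -(j : ℤ)))

/-- Crossingless connections in the annulus with `2n` outer and `p` inner marked points. The set
`B_{n,0}` is `AnnDiagram n 0`. -/
abbrev AnnDiagram (n p : ℕ) : Type := Connection (annPos (2 * n) p)

/-- The connections in `B_{n,1}`: there are two inner marked points, each of them is joined to an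
outer marked point, and these two arcs are disjoint from the lollipop. The lollipop is the segment
from the base point of the outer boundary (between the last and the first outer marked point) to
the base point of the inner boundary (between the two inner marked points). Its lifts cut the strip
into the cells that contain the points `(k, _)` with fixed `k`, so that an arc between the two
boundary circles is disjoint from it when both ends of a lift lie in the same cell. -/
def IsB1 {n : ℕ} (b : AnnDiagram n 2) : Prop :=
  ∀ j : Fin 2, ∃ l : Fin (2 * n), b.mate (0, Sum.inr j) = (0, Sum.inl l)

/-- The set `B_{n,1}`. -/
abbrev B1 (n : ℕ) : Type := {b : AnnDiagram n 2 // IsB1 b}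

/-- The set `(B_n)_1 = B_{n,0} ⊔ B_{n,1}`. -/
abbrev BOne (n : ℕ) : Type := AnnDiagram n 0 ⊕ B1 n

/-! ### The Möbius band -/

/-- The Möbius band with `m` marked points on its boundary. The generator of the deck group is a
glide reflection of the strip along its middle line, which covers the core of the crosscap. It
exchanges the two sides, and its square is the translation that corresponds to the boundary circle.
So `(k, l)` lies on the first side for even `k` and on the second side for odd `k`. -/
def mbPos (m : ℕ) : ℤ × Fin m → StripBoundary
  | (k, l) => if Even k then toLex (0, toLex (k, (l : ℤ))) else toLex (1, toLex (-k, -(l : ℤ)))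

/-- The set `Mb_n` of crossingless connections in the Möbius band with `2n` marked points. -/
abbrev MbDiagram (n : ℕ) : Type := Connection (mbPos (2 * n))

/-- The number of marked points that are ends of arcs which intersect the crosscap, that is, of arcs
whose lifts join the two sides of the strip. It is twice the number of these arcs. -/
noncomputable def crosscapEnds {n : ℕ} (m : MbDiagram n) : ℕ :=
  Nat.card {l : Fin (2 * n) // Odd (m.mate (0, l)).1}

/-- Membership in `Mb_{n,0}`: no arc intersects the crosscap. -/
def IsMb0 {n : ℕ} (m : MbDiagram n) : Prop := crosscapEnds m = 0

/-- Membership in `Mb_{n,1}`: exactly one arc intersects the crosscap. -/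
def IsMb1 {n : ℕ} (m : MbDiagram n) : Prop := crosscapEnds m = 2

/-- The set `(Mb_n)_1 = Mb_{n,0} ∪ Mb_{n,1}`. -/
abbrev MbOne (n : ℕ) : Type := {m : MbDiagram n // IsMb0 m ∨ IsMb1 m}

/-! ### Replacing the crosscap by an inner boundary -/

/-- The arcs of `m` that are disjoint from the crosscap are the arcs of `b` that are disjoint from
the inner boundary. The complement of the core of the crosscap is an annulus, in which the generator
of the deck group of the annulus is the square of the generator for the Möbius band. -/
def SameOuterArcs {n p : ℕ} (m : MbDiagram n) (b : AnnDiagram n p) : Prop :=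
  ∀ (k k' : ℤ) (l l' : Fin (2 * n)),
    b.mate (k, Sum.inl l) = (k', Sum.inl l') ↔ m.mate (2 * k, l) = (2 * k', l')

/-- `b` is obtained from `m` by replacing the crosscap by an inner boundary: one without marked
points if `m ∈ Mb_{n,0}`, and one with two marked points and a lollipop if `m ∈ Mb_{n,1}`. -/
def IsReplacement {n : ℕ} (m : MbOne n) : BOne n → Prop
  | Sum.inl b => IsMb0 m.1 ∧ SameOuterArcs m.1 b
  | Sum.inr b => IsMb1 m.1 ∧ SameOuterArcs m.1 b.1

/-! ### The bilinear forms -/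

/-- The variables `d, x, y, z, w`. -/
inductive CurveVar : Type
  | d | x | y | z | w

/-- The ring `ℤ[d, x, y, z, w]`. -/
abbrev CurveRing : Type := MvPolynomial CurveVar ℤ

/-- The fundamental group `⟨a, b ∣ a² = b²⟩` of the Klein bottle that is glued from two Möbius
bands. The cores of the first and of the second Möbius band are `a` and `b`. -/
abbrev KleinGroup : Type :=
  PresentedGroup ({FreeGroup.of 0 ^ 2 * (FreeGroup.of 1 ^ 2)⁻¹} : Set (FreeGroup (Fin 2)))

/-- The core of the first Möbius band. -/
def coreA : KleinGroup := PresentedGroup.of 0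

/-- The core of the second Möbius band. -/
def coreB : KleinGroup := PresentedGroup.of 1

/-- The graph of marked points and arcs in the Klein bottle that is glued from the Möbius band of
`m₁` and the inverted Möbius band of `m₂`. Its components are the closed curves. -/
def mbGlue {n : ℕ} (m₁ m₂ : MbDiagram n) : SimpleGraph (Fin (2 * n)) :=
  SimpleGraph.fromRel fun i j => j = (m₁.mate (0, i)).2 ∨ j = (m₂.mate (0, i)).2

/-- The preimage of these curves in the universal cover of the Klein bottle. The lifts of the marked
point `i` are the translates `(g, i)` of `(1, i)` by elements `g` of the fundamental group. -/
def mbGlueCover {n : ℕ} (m₁ m₂ : MbDiagram n) : SimpleGraph (KleinGroup × Fin (2 * n)) :=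
  SimpleGraph.fromRel fun u v =>
    v = (u.1 * coreA ^ (m₁.mate (0, u.2)).1, (m₁.mate (0, u.2)).2) ∨
    v = (u.1 * coreB ^ (m₂.mate (0, u.2)).1, (m₂.mate (0, u.2)).2)

/-- The closed curve `C` is freely homotopic, up to orientation, to the loop `g`: for a marked
point `i` on the curve, the deck transformations which preserve the lift of the curve through
`(1, i)` form the subgroup that is generated by a conjugate of `g`. -/
def IsCurveOfClass {n : ℕ} (m₁ m₂ : MbDiagram n) (C : (mbGlue m₁ m₂).ConnectedComponent)
    (g : KleinGroup) : Prop :=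
  ∃ i ∈ C.supp, ∃ c : KleinGroup,
    {h : KleinGroup | (mbGlueCover m₁ m₂).Reachable (1, i) (h, i)} =
      (Subgroup.zpowers (c * g * c⁻¹) : Set KleinGroup)

/-- The number of closed curves of class `g` in the glued diagram. -/
noncomputable def mbCount {n : ℕ} (m₁ m₂ : MbDiagram n) (g : KleinGroup) : ℕ :=
  Nat.card {C : (mbGlue m₁ m₂).ConnectedComponent // IsCurveOfClass m₁ m₂ C g}

/-- The bilinear form of type `Mb` on diagrams. The curve `d` is null homotopic, `x` and `y` are the
cores of the first and of the second crosscap, `z` is the common boundary of the two Möbius bands,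
and `w` passes once through each of the two crosscaps. -/
noncomputable def mbForm {n : ℕ} (m₁ m₂ : MbDiagram n) : CurveRing :=
  MvPolynomial.X CurveVar.d ^ mbCount m₁ m₂ 1 *
  MvPolynomial.X CurveVar.x ^ mbCount m₁ m₂ coreA *
  MvPolynomial.X CurveVar.y ^ mbCount m₁ m₂ coreB *
  MvPolynomial.X CurveVar.z ^ mbCount m₁ m₂ (coreA ^ 2) *
  MvPolynomial.X CurveVar.w ^ mbCount m₁ m₂ (coreA * coreB⁻¹)

/-- The marked points of the annulus that is glued from the annulus of `b₁ : AnnDiagram n p` and the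
inverted annulus of `b₂ : AnnDiagram n q` along their outer boundaries: the points on the common
boundary, the points on the inner and the points on the outer boundary of the result. -/
abbrev AnnVertex (n p q : ℕ) : Type := Fin (2 * n) ⊕ (Fin p ⊕ Fin q)

/-- The marked points of the first annulus as points of the glued annulus. -/
def annLeft {n p q : ℕ} : Fin (2 * n) ⊕ Fin p → AnnVertex n p q :=
  Sum.map id Sum.inl

/-- The marked points of the second annulus as points of the glued annulus. -/
def annRight {n p q : ℕ} : Fin (2 * n) ⊕ Fin q → AnnVertex n p q :=
  Sum.map id Sum.inr

/-- The graph of marked points and arcs in the glued annulus. Its components are the closed curves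
and the arcs of the glued diagram. -/
def annGlue {n p q : ℕ} (b₁ : AnnDiagram n p) (b₂ : AnnDiagram n q) :
    SimpleGraph (AnnVertex n p q) :=
  SimpleGraph.fromRel fun u v =>
    (∃ s, u = annLeft s ∧ v = annLeft (b₁.mate (0, s)).2) ∨
    (∃ s, u = annRight s ∧ v = annRight (b₂.mate (0, s)).2)

/-- The preimage of the glued diagram in the universal cover of the glued annulus. -/
def annGlueCover {n p q : ℕ} (b₁ : AnnDiagram n p) (b₂ : AnnDiagram n q) :
    SimpleGraph (ℤ × AnnVertex n p q) :=
  SimpleGraph.fromRel fun u v =>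
    (∃ s, u.2 = annLeft s ∧
      v = ((b₁.mate (u.1, s)).1, annLeft (b₁.mate (u.1, s)).2)) ∨
    (∃ s, u.2 = annRight s ∧
      v = ((b₂.mate (u.1, s)).1, annRight (b₂.mate (u.1, s)).2))

section Components

variable {n p q : ℕ} (b₁ : AnnDiagram n p) (b₂ : AnnDiagram n q)

/-- The component has an end on the inner boundary. -/
def MeetsInner (C : (annGlue b₁ b₂).ConnectedComponent) : Prop :=
  ∃ j : Fin p, Sum.inr (Sum.inl j) ∈ C.supp

/-- The component has an end on the outer boundary. -/
def MeetsOuter (C : (annGlue b₁ b₂).ConnectedComponent) : Prop :=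
  ∃ j : Fin q, Sum.inr (Sum.inr j) ∈ C.supp

/-- The component is a closed curve. -/
def IsClosedCurve (C : (annGlue b₁ b₂).ConnectedComponent) : Prop :=
  ¬ MeetsInner b₁ b₂ C ∧ ¬ MeetsOuter b₁ b₂ C

/-- The component is null homotopic: different lifts of one of its points are not connected in the
universal cover. -/
def IsNullHomotopic (C : (annGlue b₁ b₂).ConnectedComponent) : Prop :=
  ∀ v ∈ C.supp, ∀ k : ℤ, (annGlueCover b₁ b₂).Reachable (0, v) (k, v) → k = 0

/-- The bilinear form of type `B` on diagrams, with the labelling of arcs. Null homotopic closed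
curves are labelled `d` and other closed curves `z`. An arc with both ends on the inner boundary is
labelled `x`, an arc with both ends on the outer boundary is labelled `y`, and a pair of arcs which
join the inner and the outer boundary is labelled `w`. -/
noncomputable def annForm : CurveRing :=
  MvPolynomial.X CurveVar.d ^
    Nat.card {C // IsClosedCurve b₁ b₂ C ∧ IsNullHomotopic b₁ b₂ C} *
  MvPolynomial.X CurveVar.x ^
    Nat.card {C // MeetsInner b₁ b₂ C ∧ ¬ MeetsOuter b₁ b₂ C} *
  MvPolynomial.X CurveVar.y ^
    Nat.card {C // ¬ MeetsInner b₁ b₂ C ∧ MeetsOuter b₁ b₂ C} *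
  MvPolynomial.X CurveVar.z ^
    Nat.card {C // IsClosedCurve b₁ b₂ C ∧ ¬ IsNullHomotopic b₁ b₂ C} *
  MvPolynomial.X CurveVar.w ^
    (Nat.card {C // MeetsInner b₁ b₂ C ∧ MeetsOuter b₁ b₂ C} / 2)

end Components

/-- The bilinear form `⟨ , ⟩_B` on `(B_n)_1`. -/
noncomputable def formB {n : ℕ} : BOne n → BOne n → CurveRing
  | Sum.inl b₁, Sum.inl b₂ => annForm b₁ b₂
  | Sum.inl b₁, Sum.inr b₂ => annForm b₁ b₂.1
  | Sum.inr b₁, Sum.inl b₂ => annForm b₁.1 b₂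
  | Sum.inr b₁, Sum.inr b₂ => annForm b₁.1 b₂.1

/-- The bilinear form `⟨ , ⟩_Mb` on `(Mb_n)_1`. -/
noncomputable def formMb {n : ℕ} (m₁ m₂ : MbOne n) : CurveRing := mbForm m₁.1 m₂.1

/-! ### Finiteness of the sets of diagrams -/

theorem Connection.mate_add {L : Type} {pos : ℤ × L → StripBoundary} (c : Connection pos)
    (t k : ℤ) (l : L) : c.mate (k + t, l) = ((c.mate (k, l)).1 + t, (c.mate (k, l)).2) := by
  induction t using Int.induction_on with
  | zero => simp
  | succ i ih => rw [← add_assoc, c.mate_deck, ih]; simp [add_assoc]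
  | pred i ih =>
    have h := c.mate_deck (k + (-(i : ℤ) - 1)) l
    rw [show k + (-(i : ℤ) - 1) + 1 = k + -(i : ℤ) by ring, ih] at h
    have h1 := congrArg Prod.fst h
    have h2 := congrArg Prod.snd h
    simp only at h1 h2
    ext
    · simp only; omega
    · exact h2.symm

theorem Connection.finite_of_bound {L : Type} [Finite L] {pos : ℤ × L → StripBoundary}
    (P : Connection pos → Prop)
    (h : ∀ c, P c → ∀ l, -4 < (c.mate (0, l)).1 ∧ (c.mate (0, l)).1 < 4) :
    Finite {c // P c} := by
  let f : {c // P c} → (L → Set.Ioo (-4 : ℤ) 4 × L) :=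
    fun c l => (⟨(c.1.mate (0, l)).1, h c.1 c.2 l⟩, (c.1.mate (0, l)).2)
  refine Finite.of_injective f ?_
  intro c c' hcc
  apply Subtype.ext
  apply Connection.ext
  funext p
  obtain ⟨k, l⟩ := p
  have e := congrFun hcc l
  have e1 : (c.1.mate (0, l)).1 = (c'.1.mate (0, l)).1 :=
    congrArg (fun u : Set.Ioo (-4 : ℤ) 4 × L => (u.1 : ℤ)) e
  have e2 : (c.1.mate (0, l)).2 = (c'.1.mate (0, l)).2 :=
    congrArg (fun u : Set.Ioo (-4 : ℤ) 4 × L => u.2) e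
  have a := c.1.mate_add k 0 l
  have a' := c'.1.mate_add k 0 l
  rw [zero_add] at a a'
  rw [a, a', e1, e2]

theorem Connection.mate_symm {L : Type} {pos : ℤ × L → StripBoundary} (c : Connection pos)
    {l l' : L} {e : ℤ} (h : c.mate (0, l) = (e, l')) (t : ℤ) : c.mate (t, l') = (t - e, l) := by
  have h2 := c.mate_mate (0, l)
  rw [h] at h2
  have h3 := c.mate_add (t - e) e l'
  rw [h2] at h3
  simpa using h3

theorem Connection.mate_eq {L : Type} {pos : ℤ × L → StripBoundary} (c : Connection pos)
    {l l' : L} {e : ℤ} (h : c.mate (0, l) = (e, l')) (t : ℤ) : c.mate (t, l) = (t + e, l') := by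
  have h3 := c.mate_add t 0 l
  rw [h] at h3
  simpa [add_comm] using h3

theorem annDiagram_outer_lt {n p : ℕ} (b : AnnDiagram n p) {l l' : Fin (2 * n)} {e : ℤ}
    (h : b.mate (0, Sum.inl l) = (e, Sum.inl l')) : e < 4 := by
  by_contra hlt
  refine b.noncrossing (0, Sum.inl l) (1, Sum.inl l) ?_
  rw [h, b.mate_eq h]
  simp only [annPos, Prod.Lex.toLex_lt_toLex, lt_self_iff_false, false_or, true_and]
  exact ⟨Or.inl (by omega), Or.inl (by omega), Or.inl (by omega)⟩

theorem annDiagram_outer_bound {n p : ℕ} (b : AnnDiagram n p) {l l' : Fin (2 * n)} {e : ℤ}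
    (h : b.mate (0, Sum.inl l) = (e, Sum.inl l')) : -4 < e ∧ e < 4 := by
  have h' := b.mate_symm h 0
  have := annDiagram_outer_lt b h
  have := annDiagram_outer_lt b h'
  omega

theorem mbDiagram_lt {n : ℕ} (m : MbDiagram n) {l l' : Fin (2 * n)} {e : ℤ}
    (h : m.mate (0, l) = (e, l')) : e < 4 := by
  by_contra hlt
  rcases Int.even_or_odd e with he | he
  · refine m.noncrossing (0, l) (2, l) ?_
    have he2 : Even (2 + e) := even_two.add he
    rw [h, m.mate_eq h]
    simp only [mbPos, Prod.Lex.toLex_lt_toLex, he, he2, if_true, Even.zero, even_two,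
      lt_self_iff_false, false_or, true_and]
    exact ⟨Or.inl (by omega), Or.inl (by omega), Or.inl (by omega)⟩
  · refine m.noncrossing (0, l) (2, l') ?_
    have he1 : ¬ Even e := Int.not_even_iff_odd.2 he
    have he2 : ¬ Even (2 - e) := Int.not_even_iff_odd.2 (even_two.sub_odd he)
    rw [h, m.mate_symm h]
    simp only [mbPos, Prod.Lex.toLex_lt_toLex, he1, he2, if_true, if_false, Even.zero, even_two,
      lt_self_iff_false, false_or, true_and]
    exact ⟨Or.inl (by omega), Or.inl (by norm_num), Or.inl (by omega)⟩

instance (n : ℕ) : Finite (MbOne n) := by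
  refine Connection.finite_of_bound _ fun m _ l => ?_
  have h : m.mate (0, l) = ((m.mate (0, l)).1, (m.mate (0, l)).2) := rfl
  have h1 := mbDiagram_lt m h
  have h2 := mbDiagram_lt m (m.mate_symm h 0)
  omega

instance (n : ℕ) : Finite (AnnDiagram n 0) := by
  have : Finite {c : AnnDiagram n 0 // True} := by
    refine Connection.finite_of_bound _ fun b _ s => ?_
    rcases s with l | j
    · rcases h : b.mate (0, Sum.inl l) with ⟨e, l' | j⟩
      · exact annDiagram_outer_bound b h
      · exact j.elim0
    · exact j.elim0
  exact Finite.of_equiv _ (Equiv.subtypeUnivEquiv fun _ => trivial)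

instance (n : ℕ) : Finite (B1 n) := by
  refine Connection.finite_of_bound _ fun b hb s => ?_
  rcases s with l | j
  · rcases h : b.mate (0, Sum.inl l) with ⟨e, l' | j⟩
    · exact annDiagram_outer_bound b h
    · obtain ⟨l', hl'⟩ := hb j
      have h1 := b.mate_symm h 0
      rw [hl'] at h1
      have h2 := congrArg Prod.fst h1
      simp only at h2 ⊢
      omega
  · obtain ⟨l', hl'⟩ := hb j
    rw [hl']
    simp

noncomputable instance (n : ℕ) : Fintype (MbOne n) := Fintype.ofFinite _

noncomputable instance (n : ℕ) : Fintype (BOne n) := Fintype.ofFinite _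

/-! ### The Gram determinants -/

/-- The Gram matrix of type `(Mb)_1`. -/
noncomputable def gramMatrixMb (n : ℕ) : Matrix (MbOne n) (MbOne n) CurveRing :=
  Matrix.of formMb

/-- The Gram matrix of type `(B)_1`. -/
noncomputable def gramMatrixB (n : ℕ) : Matrix (BOne n) (BOne n) CurveRing :=
  Matrix.of formB

open Classical in
/-- The Gram determinant of type `(Mb)_1`. -/
noncomputable def gramDetMb (n : ℕ) : CurveRing := (gramMatrixMb n).det

open Classical in
/-- The Gram determinant of type `(B)_1`. -/
noncomputable def gramDetB (n : ℕ) : CurveRing := (gramMatrixB n).det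

end SurfaceGram

/-!
The diagrams of both kinds are invariant noncrossing matchings of the lifts of the marked points, and
the proof works with these matchings.

*The bijection.* In a diagram of `(Mb_n)_1` at most one arc intersects the crosscap. Since the lifts
of this arc do not intersect each other, it is determined by its ends (`shift_of_mem_crossing`). In
the same way the two arcs of a diagram in `B_{n,1}` that end on the inner boundary are determined by
their outer ends (`strictMono_of_inner`). No other arc passes over one of these ends, so that the
crosscap can be exchanged for an inner boundary and back (`exists_ann_isCut`, `exists_mb_isCut`).

*The curves as pieces of curves.* The closed curves in the Klein bottle are the orbits of two fixed
point free involutions on the marked points. The curves and arcs in the glued annulus are the pieces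
into which these orbits fall when the arcs that intersect the crosscaps are removed
(`annGlue_reachable_iff`). A curve remains in one piece when at most one arc is removed, and it falls
into two pieces, each with an end at either crosscap, when one arc of each of the two diagrams is
removed (`MatchingPair.linked_of_disjoint_right`, `MatchingPair.linked_split`). This explains the
exponents of `x`, `y` and `w`, as soon as a closed curve in the Klein bottle is known to be homotopic
to the loop that is prescribed by the crosscaps which it meets.

*The homotopy classes.* An essential simple closed curve in an annulus winds around it exactly once
(`winding_mem`). In the universal cover, a lift of the curve which differs from its translate by the
generator of the deck group would lie on one side of this translate, while the lifts of the curve are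
permuted cyclically. The discrete form of this argument counts, modulo `2`, the arcs of the lift that
pass over or below a point (`orbit_translate`).

In the Klein bottle `⟨a, b ∣ a² = b²⟩` the element `a²` is central. Replace the arc that intersects
the first crosscap by an arc in the annulus. There are two ways to do this, which differ by one turn
around the annulus, and the same holds for the second crosscap. If `W` is the winding number after
one such replacement, the closed curve represents `a^(2W) a^e b^f`, where `e` and `f` are `0` or `±1`
according to the passages through the crosscaps, and `W + e`, `W + f` and `W + e + f` are the winding
numbers after the other replacements. All of these are `0` or `±1`, and this forces the element to be
`1` or `a^(±2)`, `a^(±1)`, `b^(±1)`, or a conjugate of `a b⁻¹` up to inversion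
(`label_of_disjoint`, `label_of_left`, `label_of_right`, `label_of_both`). These classes are told
apart in the abelianization (`isCurveOfClass_unique`).
-/

namespace SurfaceGram

/-! ### Pairs of perfect matchings -/

/-- Two perfect matchings of a set of points, each recorded by its fixed point free involution.
The points are the marked points on the seam of a glued surface, or their lifts, and the two
matchings come from the two sides of the seam. -/
structure MatchingPair (X : Type) where
  f : Equiv.Perm X
  g : Equiv.Perm X
  f_f : ∀ x, f (f x) = x
  g_g : ∀ x, g (g x) = x
  f_ne : ∀ x, f x ≠ x
  g_ne : ∀ x, g x ≠ x

namespace MatchingPair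

variable {X Y : Type} (D : MatchingPair X)

/-- The same matchings in the other order. -/
def swap : MatchingPair X := ⟨D.g, D.f, D.g_g, D.f_f, D.g_ne, D.f_ne⟩

/-- The step along two consecutive arcs, one of each matching. -/
def turn : Equiv.Perm X := D.g * D.f

theorem turn_apply (x : X) : D.turn x = D.g (D.f x) := rfl

theorem g_turn (x : X) : D.g (D.turn x) = D.f x := D.g_g _

theorem turn_turn_pow (i : ℕ) (x : X) : D.turn ((D.turn ^ i) x) = (D.turn ^ (i + 1)) x := by
  rw [pow_succ', Equiv.Perm.mul_apply]

theorem turn_turn_zpow (i : ℤ) (x : X) : D.turn ((D.turn ^ i) x) = (D.turn ^ (i + 1)) x := by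
  rw [add_comm, zpow_one_add, Equiv.Perm.mul_apply]

/-- The points `x` and `y` lie on the same curve. -/
def Orbit : X → X → Prop :=
  Relation.EqvGen fun x y => y = D.f x ∨ y = D.g x

/-- The points `x` and `y` lie on the same piece, after the arcs of the first matching that end in
`A` and the arcs of the second matching that end in `B` have been removed. -/
def Linked (A B : Set X) : X → X → Prop :=
  Relation.EqvGen fun x y => (x ∉ A ∧ y = D.f x) ∨ (x ∉ B ∧ y = D.g x)

variable {D}

theorem Orbit.refl (x : X) : D.Orbit x x := Relation.EqvGen.refl x

theorem Orbit.symm {x y : X} (h : D.Orbit x y) : D.Orbit y x := Relation.EqvGen.symm _ _ h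

theorem Orbit.trans {x y z : X} (h : D.Orbit x y) (h' : D.Orbit y z) : D.Orbit x z :=
  Relation.EqvGen.trans _ _ _ h h'

theorem orbit_f (x : X) : D.Orbit x (D.f x) := Relation.EqvGen.rel _ _ (Or.inl rfl)

theorem orbit_g (x : X) : D.Orbit x (D.g x) := Relation.EqvGen.rel _ _ (Or.inr rfl)

theorem eqvGen_iff {r : X → X → Prop} {p : X → Prop} (h : ∀ x y, r x y → (p x ↔ p y)) {x y : X}
    (hxy : Relation.EqvGen r x y) : p x ↔ p y := by
  induction hxy with
  | rel x y hr => exact h x y hr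
  | refl x => exact Iff.rfl
  | symm x y _ ih => exact ih.symm
  | trans x y z _ _ ih ih' => exact ih.trans ih'

theorem Orbit.map {E : MatchingPair Y} {π : X → Y} (hf : ∀ x, π (D.f x) = E.f (π x))
    (hg : ∀ x, π (D.g x) = E.g (π x)) {x y : X} (h : D.Orbit x y) : E.Orbit (π x) (π y) := by
  refine (eqvGen_iff (p := fun y => E.Orbit (π x) (π y)) ?_ h).1 (Orbit.refl _)
  rintro y z (rfl | rfl)
  · rw [hf]; exact ⟨(·.trans (orbit_f _)), (·.trans (orbit_f _).symm)⟩
  · rw [hg]; exact ⟨(·.trans (orbit_g _)), (·.trans (orbit_g _).symm)⟩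

theorem orbit_turn_zpow (x : X) (i : ℤ) : D.Orbit x ((D.turn ^ i) x) := by
  have key : ∀ y, D.Orbit y (D.turn y) := fun y => (orbit_f y).trans (orbit_g _)
  induction i using Int.induction_on with
  | zero => exact Orbit.refl x
  | succ i ih =>
    rw [add_comm, zpow_add, zpow_one, Equiv.Perm.mul_apply]
    exact ih.trans (key _)
  | pred i ih =>
    refine ih.trans (Orbit.symm ?_)
    have := key ((D.turn ^ (-(i : ℤ) - 1)) x)
    rwa [D.turn_turn_zpow, sub_add_cancel] at this

theorem orbit_turn_pow (x : X) (i : ℕ) : D.Orbit x ((D.turn ^ i) x) := by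
  simpa using orbit_turn_zpow (D := D) x i

variable (D) in
/-- The two involutions generate a dihedral group. -/
theorem f_turn_zpow (i : ℤ) (x : X) : D.f ((D.turn ^ i) x) = (D.turn ^ (-i)) (D.f x) := by
  have h1 : D.f * D.turn * D.f⁻¹ = D.turn⁻¹ := by
    rw [eq_inv_iff_mul_eq_one]
    have hf : D.f⁻¹ = D.f := by
      rw [inv_eq_iff_mul_eq_one]; ext x; exact D.f_f x
    rw [hf]
    ext x
    simp [turn, D.f_f, D.g_g]
  have h2 : D.f * D.turn ^ i * D.f⁻¹ = D.turn ^ (-i) := by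
    rw [← conj_zpow, h1, inv_zpow, zpow_neg]
  rw [← h2]
  simp

theorem orbit_iff {x y : X} :
    D.Orbit x y ↔ ∃ i : ℤ, y = (D.turn ^ i) x ∨ y = D.f ((D.turn ^ i) x) := by
  constructor
  · intro h
    refine (eqvGen_iff (p := fun y => ∃ i : ℤ, y = (D.turn ^ i) x ∨ y = D.f ((D.turn ^ i) x))
      ?_ h).1 ⟨0, Or.inl rfl⟩
    have hf : ∀ y, (∃ i : ℤ, y = (D.turn ^ i) x ∨ y = D.f ((D.turn ^ i) x)) →
        ∃ i : ℤ, D.f y = (D.turn ^ i) x ∨ D.f y = D.f ((D.turn ^ i) x) := by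
      rintro y ⟨i, rfl | rfl⟩
      · exact ⟨i, Or.inr rfl⟩
      · exact ⟨i, Or.inl (D.f_f _)⟩
    have hg : ∀ y, (∃ i : ℤ, y = (D.turn ^ i) x ∨ y = D.f ((D.turn ^ i) x)) →
        ∃ i : ℤ, D.g y = (D.turn ^ i) x ∨ D.g y = D.f ((D.turn ^ i) x) := by
      rintro y ⟨i, rfl | rfl⟩
      · refine ⟨i - 1, Or.inr ?_⟩
        rw [← D.g_turn, D.turn_turn_zpow, sub_add_cancel]
      · refine ⟨i + 1, Or.inl ?_⟩
        rw [add_comm, zpow_one_add]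
        rfl
    rintro y z (rfl | rfl)
    · exact ⟨hf y, fun h => by simpa only [D.f_f] using hf _ h⟩
    · exact ⟨hg y, fun h => by simpa only [D.g_g] using hg _ h⟩
  · rintro ⟨i, rfl | rfl⟩
    · exact orbit_turn_zpow x i
    · exact (orbit_turn_zpow x i).trans (orbit_f _)

variable (D) in
/-- The reflections of the dihedral group have no fixed points: such a point would yield a fixed
point of one of the two matchings. -/
theorem f_turn_zpow_ne (i : ℤ) (x : X) : D.f ((D.turn ^ i) x) ≠ x := by
  intro h
  obtain ⟨j, rfl | rfl⟩ := Int.even_or_odd' i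
  · rw [two_mul, zpow_add, Equiv.Perm.mul_apply, D.f_turn_zpow, zpow_neg,
      Equiv.Perm.inv_eq_iff_eq] at h
    exact D.f_ne _ h
  · rw [show 2 * j + 1 = j + (1 + j) by ring, zpow_add, Equiv.Perm.mul_apply, D.f_turn_zpow,
      zpow_neg, Equiv.Perm.inv_eq_iff_eq, zpow_one_add, Equiv.Perm.mul_apply, turn_apply] at h
    apply D.g_ne (D.f ((D.turn ^ j) x))
    rw [← D.f_f (D.g _), h]

theorem f_turn_pow_ne_turn_pow (i j : ℕ) (x : X) : D.f ((D.turn ^ i) x) ≠ (D.turn ^ j) x := by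
  intro h
  apply D.f_turn_zpow_ne (i + j) x
  have h' := congrArg (D.turn ^ (-(j : ℤ))) h
  have e : (D.turn ^ (-(j : ℤ))) ((D.turn ^ j) x) = x := by
    rw [← zpow_natCast, ← Equiv.Perm.mul_apply, ← zpow_add]; simp
  rw [e, ← D.f_turn_zpow, ← zpow_natCast, ← Equiv.Perm.mul_apply (D.turn ^ (j : ℤ)),
    ← zpow_add, add_comm] at h'
  exact h'

/-! ### Closed curves of a pair of matchings of a finite set -/

variable (D) in
/-- Half of the number of points on the curve through `x`. -/
noncomputable def period (x : X) : ℕ := MulAction.period D.turn x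

theorem turn_pow_period (x : X) : (D.turn ^ D.period x) x = x :=
  MulAction.pow_period_smul D.turn x

theorem turn_zpow_eq_iff {x : X} {i : ℤ} : (D.turn ^ i) x = x ↔ (D.period x : ℤ) ∣ i :=
  MulAction.zpow_smul_eq_iff_period_dvd (g := D.turn) (a := x)

theorem period_pos [Finite X] (x : X) : 0 < D.period x :=
  MulAction.period_pos_of_orderOf_pos (orderOf_pos _) x

theorem turn_pow_injOn {x : X} {i j : ℕ} (hi : i < D.period x) (hj : j < D.period x)
    (h : (D.turn ^ i) x = (D.turn ^ j) x) : i = j := by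
  have h' : (D.turn ^ ((i : ℤ) - j)) x = x := by
    rw [sub_eq_neg_add, zpow_add, Equiv.Perm.mul_apply, zpow_natCast, h, ← zpow_natCast,
      ← Equiv.Perm.mul_apply, ← zpow_add]
    simp
  rw [turn_zpow_eq_iff] at h'
  have := Int.eq_zero_of_abs_lt_dvd h' (by rw [abs_lt]; omega)
  omega

theorem orbit_iff_lt [Finite X] {x y : X} :
    D.Orbit x y ↔ ∃ i < D.period x, y = (D.turn ^ i) x ∨ y = D.f ((D.turn ^ i) x) := by
  rw [orbit_iff]
  constructor
  · rintro ⟨i, hi⟩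
    have hP := D.period_pos x
    have e : (D.turn ^ (i % (D.period x : ℤ)).toNat) x = (D.turn ^ i) x := by
      rw [← zpow_natCast, Int.toNat_of_nonneg (Int.emod_nonneg _ (by omega))]
      exact MulAction.zpow_mod_period_smul (g := D.turn) (a := x) i
    refine ⟨(i % (D.period x : ℤ)).toNat, ?_, ?_⟩
    · have := Int.emod_lt_of_pos i (by omega : (0 : ℤ) < D.period x)
      omega
    · rwa [e]
  · rintro ⟨i, -, hi⟩
    exact ⟨i, by simpa using hi⟩

/-- Let `π` be a map of points that respects the matchings, such as the projection from a universal
cover. The points over `π x` on the curve through `x` are reached by going a number of times around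
the curve through `π x`. -/
theorem orbit_fiber {E : MatchingPair Y} {π : X → Y} (hf : ∀ x, π (D.f x) = E.f (π x))
    (hg : ∀ x, π (D.g x) = E.g (π x)) {x y : X} :
    D.Orbit x y ∧ π y = π x ↔ ∃ j : ℤ, y = ((D.turn ^ E.period (π x)) ^ j) x := by
  have ht : ∀ (i : ℤ) (x : X), π ((D.turn ^ i) x) = (E.turn ^ i) (π x) := by
    have h1 : ∀ x, π (D.turn x) = E.turn (π x) := fun x => by
      rw [turn_apply, hg, hf, turn_apply]
    intro i
    induction i using Int.induction_on with
    | zero => intro x; rfl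
    | succ i ih => intro x; simp only [zpow_add_one, Equiv.Perm.mul_apply, ih, h1]
    | pred i ih =>
      intro x
      have := h1 ((D.turn⁻¹) x)
      rw [← Equiv.Perm.mul_apply, mul_inv_cancel, Equiv.Perm.one_apply,
        ← Equiv.Perm.inv_eq_iff_eq, eq_comm] at this
      simp only [zpow_sub_one, Equiv.Perm.mul_apply, ih, this]
  constructor
  · rintro ⟨h, hπ⟩
    rw [orbit_iff] at h
    obtain ⟨i, rfl | rfl⟩ := h
    · rw [ht, turn_zpow_eq_iff] at hπ
      obtain ⟨j, rfl⟩ := hπ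
      exact ⟨j, by rw [zpow_mul, zpow_natCast]⟩
    · rw [hf, ht] at hπ
      exact absurd hπ (E.f_turn_zpow_ne _ _)
  · rintro ⟨j, rfl⟩
    rw [← zpow_natCast, ← zpow_mul]
    exact ⟨orbit_turn_zpow _ _, by rw [ht, turn_zpow_eq_iff]; exact dvd_mul_right _ _⟩

/-! ### Removing arcs from a closed curve -/

variable {A B : Set X}

theorem Linked.refl (x : X) : D.Linked A B x x := Relation.EqvGen.refl x

theorem Linked.symm {x y : X} (h : D.Linked A B x y) : D.Linked A B y x :=
  Relation.EqvGen.symm _ _ h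

theorem Linked.trans {x y z : X} (h : D.Linked A B x y) (h' : D.Linked A B y z) :
    D.Linked A B x z := Relation.EqvGen.trans _ _ _ h h'

theorem linked_f {x : X} (h : x ∉ A) : D.Linked A B x (D.f x) :=
  Relation.EqvGen.rel _ _ (Or.inl ⟨h, rfl⟩)

theorem linked_g {x : X} (h : x ∉ B) : D.Linked A B x (D.g x) :=
  Relation.EqvGen.rel _ _ (Or.inr ⟨h, rfl⟩)

theorem Linked.orbit {x y : X} (h : D.Linked A B x y) : D.Orbit x y :=
  Relation.EqvGen.mono (fun _ _ h => h.imp And.right And.right) _ _ h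

theorem linked_swap {x y : X} : D.swap.Linked B A x y ↔ D.Linked A B x y := by
  constructor <;> exact Relation.EqvGen.mono (fun _ _ h => h.symm) _ _

theorem orbit_swap {x y : X} : D.swap.Orbit x y ↔ D.Orbit x y := by
  constructor <;> exact Relation.EqvGen.mono (fun _ _ h => h.symm) _ _

/-- The set `A` consists of the ends of at most one arc of the matching `f`. -/
def IsArcEnds (f : X → X) (A : Set X) : Prop :=
  (∀ x ∈ A, f x ∈ A) ∧ ∀ x ∈ A, ∀ y ∈ A, y = x ∨ y = f x

/-- A closed curve from which one arc is removed remains connected: the rest of the curve leads from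
one end of the arc to the other. -/
theorem linked_of_disjoint_right [Finite X] (hA : IsArcEnds D.f A) {x y : X} (h : D.Orbit x y)
    (hB : ∀ z, D.Orbit x z → z ∉ B) : D.Linked A B x y := by
  have key : ∀ l ∈ A, D.Orbit x l → D.Linked A B l (D.f l) := by
    intro l hl hxl
    have chain : ∀ i < D.period l, D.Linked A B (D.f l) (D.f ((D.turn ^ i) l)) ∧
        D.Linked A B (D.f l) ((D.turn ^ (i + 1)) l) := by
      have hg : ∀ i, D.Linked A B (D.f ((D.turn ^ i) l)) ((D.turn ^ (i + 1)) l) := by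
        intro i
        rw [pow_succ', Equiv.Perm.mul_apply, turn_apply]
        exact linked_g (hB _ ((hxl.trans (orbit_turn_pow l i)).trans (orbit_f _)))
      intro i
      induction i with
      | zero => exact fun _ => ⟨Linked.refl _, hg 0⟩
      | succ i ih =>
        intro hi
        have h1 := (ih (by omega)).2
        have h2 : (D.turn ^ (i + 1)) l ∉ A := by
          intro hmem
          rcases hA.2 l hl _ hmem with h | h
          · have := turn_pow_injOn hi (D.period_pos l) (by simpa using h)
            omega
          · exact f_turn_pow_ne_turn_pow 0 (i + 1) l (by simpa using h.symm)
        have h3 := h1.trans (linked_f h2)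
        exact ⟨h3, h3.trans (hg _)⟩
    have hP := D.period_pos l
    have h := (chain (D.period l - 1) (by omega)).2
    rw [Nat.sub_add_cancel hP, turn_pow_period] at h
    exact h.symm
  have hstep : ∀ z, D.Orbit x z → D.Linked A B z (D.f z) ∧ D.Linked A B z (D.g z) := by
    intro z hz
    refine ⟨?_, linked_g (hB z hz)⟩
    by_cases hzA : z ∈ A
    · exact key z hzA hz
    · exact linked_f hzA
  refine ((eqvGen_iff (p := fun y => D.Orbit x y ∧ D.Linked A B x y) ?_ h).1
    ⟨Orbit.refl x, Linked.refl x⟩).2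
  rintro u v (rfl | rfl)
  · refine ⟨fun hu => ⟨hu.1.trans (orbit_f u), hu.2.trans (hstep u hu.1).1⟩, fun hu => ?_⟩
    have h1 := hu.1.trans (orbit_f u).symm
    exact ⟨h1, hu.2.trans (hstep u h1).1.symm⟩
  · refine ⟨fun hu => ⟨hu.1.trans (orbit_g u), hu.2.trans (hstep u hu.1).2⟩, fun hu => ?_⟩
    have h1 := hu.1.trans (orbit_g u).symm
    exact ⟨h1, hu.2.trans (hstep u h1).2.symm⟩

theorem linked_of_disjoint_left [Finite X] (hB : IsArcEnds D.g B) {x y : X} (h : D.Orbit x y)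
    (hA : ∀ z, D.Orbit x z → z ∉ A) : D.Linked A B x y := by
  rw [← linked_swap]
  exact linked_of_disjoint_right (D := D.swap) hB (orbit_swap.2 h)
    fun z hz => hA z (orbit_swap.1 hz)

/-- A closed curve that starts at `l` with an arc of the first matching runs exactly once through an
arc of the second matching that it contains, before it returns to `l`. -/
theorem exists_unique_crossing [Finite X] (hB : IsArcEnds D.g B) {l b : X} (hb : b ∈ B)
    (h : D.Orbit l b) : ∃ r < D.period l, D.f ((D.turn ^ r) l) ∈ B ∧
      ∀ i < D.period l, D.f ((D.turn ^ i) l) ∈ B → i = r := by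
  have hex : ∃ r < D.period l, D.f ((D.turn ^ r) l) ∈ B := by
    obtain ⟨i, hi, h | h⟩ := orbit_iff_lt.1 h
    · have hP := D.period_pos l
      rcases Nat.eq_zero_or_pos i with rfl | hi0
      · refine ⟨D.period l - 1, by omega, ?_⟩
        rw [← D.g_turn, D.turn_turn_pow, Nat.sub_add_cancel hP,
          turn_pow_period]
        have hbl : b = l := by simpa using h
        rw [← hbl]
        exact hB.1 b hb
      · refine ⟨i - 1, by omega, ?_⟩
        rw [← D.g_turn, D.turn_turn_pow, Nat.sub_add_cancel hi0, ← h]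
        exact hB.1 b hb
    · exact ⟨i, hi, h ▸ hb⟩
  obtain ⟨r, hr, hrB⟩ := hex
  refine ⟨r, hr, hrB, fun i hi hiB => ?_⟩
  rcases hB.2 _ hrB _ hiB with h | h
  · exact turn_pow_injOn hi hr (D.f.injective h)
  · rw [← turn_apply, D.turn_turn_pow] at h
    exact absurd h (f_turn_pow_ne_turn_pow _ _ _)

/-- A closed curve falls into two pieces when an arc of each of the two matchings is removed. Each
piece leads from an end of the first arc to an end of the second arc. -/
theorem linked_split [Finite X] (hA : IsArcEnds D.f A) (hB : IsArcEnds D.g B) {l b : X}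
    (hl : l ∈ A) (hb : b ∈ B) (h : D.Orbit l b) :
    ¬ D.Linked A B l (D.f l) ∧ ∃ c ∈ B, D.Linked A B (D.f l) c ∧ D.Linked A B l (D.g c) := by
  obtain ⟨r, hr, hrB, huniq⟩ := exists_unique_crossing hB hb h
  have notA : ∀ i, 0 < i → i < D.period l → (D.turn ^ i) l ∉ A := by
    intro i hi0 hi hmem
    rcases hA.2 l hl _ hmem with h | h
    · have := turn_pow_injOn hi (D.period_pos l) (by simpa using h)
      omega
    · exact f_turn_pow_ne_turn_pow 0 i l (by simpa using h.symm)
  refine ⟨?_, D.f ((D.turn ^ r) l), hrB, ?_, ?_⟩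
  · intro hlink
    -- the piece that ends in `f l`
    let p : X → Prop := fun x => ∃ i ≤ r, x = D.f ((D.turn ^ i) l) ∨ (0 < i ∧ x = (D.turn ^ i) l)
    have hf : ∀ x, x ∉ A → p x → p (D.f x) := by
      rintro x hx ⟨i, hi, rfl | ⟨hi0, rfl⟩⟩
      · rcases Nat.eq_zero_or_pos i with rfl | hi0
        · exact absurd (hA.1 l hl) hx
        · exact ⟨i, hi, Or.inr ⟨hi0, D.f_f _⟩⟩
      · exact ⟨i, hi, Or.inl rfl⟩
    have hg : ∀ x, x ∉ B → p x → p (D.g x) := by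
      rintro x hx ⟨i, hi, rfl | ⟨hi0, rfl⟩⟩
      · have hir : i ≠ r := by rintro rfl; exact hx hrB
        exact ⟨i + 1, by omega, Or.inr ⟨by omega, by rw [pow_succ']; rfl⟩⟩
      · refine ⟨i - 1, by omega, Or.inl ?_⟩
        rw [← D.g_turn, D.turn_turn_pow, Nat.sub_add_cancel hi0]
    have hfA : ∀ x, x ∉ A → D.f x ∉ A := fun x hx hmem => hx (D.f_f x ▸ hA.1 _ hmem)
    have hgB : ∀ x, x ∉ B → D.g x ∉ B := fun x hx hmem => hx (D.g_g x ▸ hB.1 _ hmem)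
    have hp : p l ↔ p (D.f l) := by
      refine eqvGen_iff ?_ hlink
      rintro x y (⟨hx, rfl⟩ | ⟨hx, rfl⟩)
      · exact ⟨hf x hx, fun h => by simpa only [D.f_f] using hf _ (hfA x hx) h⟩
      · exact ⟨hg x hx, fun h => by simpa only [D.g_g] using hg _ (hgB x hx) h⟩
    obtain ⟨i, hi, h | ⟨hi0, h⟩⟩ := hp.2 ⟨0, Nat.zero_le _, Or.inl rfl⟩
    · exact f_turn_pow_ne_turn_pow i 0 l (by simpa using h.symm)
    · have := turn_pow_injOn (i := i) (by omega) (D.period_pos l) (by simpa using h.symm)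
      omega
  · have chain : ∀ i ≤ r, D.Linked A B (D.f l) (D.f ((D.turn ^ i) l)) := by
      intro i
      induction i with
      | zero => exact fun _ => Linked.refl _
      | succ i ih =>
        intro hi
        have h1 : D.f ((D.turn ^ i) l) ∉ B := fun hmem => by
          have := huniq i (by omega) hmem
          omega
        have h2 := (ih (by omega)).trans (linked_g h1)
        rw [← turn_apply, D.turn_turn_pow] at h2
        exact h2.trans (linked_f (notA _ (by omega) (by omega)))
    exact chain r le_rfl
  · have chain : ∀ k, r + 1 + k ≤ D.period l →
        D.Linked A B ((D.turn ^ (r + 1)) l) ((D.turn ^ (r + 1 + k)) l) := by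
      intro k
      induction k with
      | zero => exact fun _ => Linked.refl _
      | succ k ih =>
        intro hk
        have h1 := (ih (by omega)).trans (linked_f (notA (r + 1 + k) (by omega) (by omega)))
        have h2 : D.f ((D.turn ^ (r + 1 + k)) l) ∉ B := fun hmem => by
          have := huniq _ (by omega) hmem
          omega
        have h3 := h1.trans (linked_g h2)
        rwa [← turn_apply, D.turn_turn_pow] at h3
    have h := chain (D.period l - (r + 1)) (by omega)
    rw [Nat.add_sub_cancel' (by omega), turn_pow_period, pow_succ', Equiv.Perm.mul_apply,
      turn_apply] at h
    exact h.symm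

theorem linked_or_linked_f [Finite X] (hA : IsArcEnds D.f A) (hB : IsArcEnds D.g B) {l b x : X}
    (hl : l ∈ A) (hb : b ∈ B) (h : D.Orbit l b) (hx : D.Orbit l x) :
    D.Linked A B l x ∨ D.Linked A B (D.f l) x := by
  obtain ⟨-, c, hc, hc₁, hc₂⟩ := linked_split hA hB hl hb h
  have key : ∀ x y, (x ∉ A ∧ y = D.f x) ∨ (x ∉ B ∧ y = D.g x) ∨ (x ∈ A ∧ y = D.f x) ∨
      (x ∈ B ∧ y = D.g x) → (D.Linked A B l x ∨ D.Linked A B (D.f l) x) →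
      (D.Linked A B l y ∨ D.Linked A B (D.f l) y) := by
    rintro x y (⟨hx, rfl⟩ | ⟨hx, rfl⟩ | ⟨hx, rfl⟩ | ⟨hx, rfl⟩) h
    · exact h.imp (·.trans (linked_f hx)) (·.trans (linked_f hx))
    · exact h.imp (·.trans (linked_g hx)) (·.trans (linked_g hx))
    · rcases hA.2 l hl _ (hA.1 x hx) with h' | h'
      · exact Or.inl (h' ▸ Linked.refl _)
      · exact Or.inr (h' ▸ Linked.refl _)
    · rcases hB.2 c hc _ (hB.1 x hx) with h' | h'
      · exact Or.inr (h' ▸ hc₁)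
      · exact Or.inl (h' ▸ hc₂)
  refine (eqvGen_iff (p := fun x => D.Linked A B l x ∨ D.Linked A B (D.f l) x) ?_ hx).1
    (Or.inl (Linked.refl l))
  have hf : ∀ x, (D.Linked A B l x ∨ D.Linked A B (D.f l) x) →
      (D.Linked A B l (D.f x) ∨ D.Linked A B (D.f l) (D.f x)) := fun x =>
    key x _ (by by_cases hx : x ∈ A <;> simp [hx])
  have hg : ∀ x, (D.Linked A B l x ∨ D.Linked A B (D.f l) x) →
      (D.Linked A B l (D.g x) ∨ D.Linked A B (D.f l) (D.g x)) := fun x =>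
    key x _ (by by_cases hx : x ∈ B <;> simp [hx])
  rintro x y (rfl | rfl)
  · exact ⟨hf x, fun h => by simpa only [D.f_f] using hf _ h⟩
  · exact ⟨hg x, fun h => by simpa only [D.g_g] using hg _ h⟩

/-- A piece of a closed curve has an end on the arc that is removed from the first matching if the
closed curve runs through this arc. -/
theorem exists_linked_left_iff [Finite X] (hA : IsArcEnds D.f A) (hB : IsArcEnds D.g B) {x : X} :
    (∃ u ∈ A, D.Linked A B x u) ↔ ∃ u ∈ A, D.Orbit x u := by
  refine ⟨fun ⟨u, hu, h⟩ => ⟨u, hu, h.orbit⟩, fun ⟨l, hl, h⟩ => ?_⟩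
  by_cases hb : ∃ b ∈ B, D.Orbit x b
  · obtain ⟨b, hb, hxb⟩ := hb
    rcases linked_or_linked_f hA hB hl hb (h.symm.trans hxb) h.symm with h' | h'
    · exact ⟨l, hl, h'.symm⟩
    · exact ⟨_, hA.1 l hl, h'.symm⟩
  · exact ⟨l, hl, linked_of_disjoint_right hA h fun z hz hzB => hb ⟨z, hzB, hz⟩⟩

theorem exists_linked_right_iff [Finite X] (hA : IsArcEnds D.f A) (hB : IsArcEnds D.g B) {x : X} :
    (∃ u ∈ B, D.Linked A B x u) ↔ ∃ u ∈ B, D.Orbit x u := by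
  simpa only [linked_swap, orbit_swap] using exists_linked_left_iff (D := D.swap) hB hA (x := x)

end MatchingPair

/-! ### Connections as matchings with shifts -/

namespace Connection

variable {L : Type} {pos pos' : ℤ × L → StripBoundary} (c : Connection pos)

/-- The marked point at the other end of the arc that starts at `l`. -/
def opp (l : L) : L := (c.mate (0, l)).2

/-- The deck transformation that is picked up along the arc that starts at `l`. -/
def shift (l : L) : ℤ := (c.mate (0, l)).1

theorem mate_mk (k : ℤ) (l : L) : c.mate (k, l) = (k + c.shift l, c.opp l) :=
  c.mate_eq (Prod.ext rfl rfl : c.mate (0, l) = (c.shift l, c.opp l)) k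

theorem opp_opp (l : L) : c.opp (c.opp l) = l := by
  have h := c.mate_mate (0, l)
  rw [c.mate_mk 0, mate_mk] at h
  exact congrArg Prod.snd h

theorem shift_opp (l : L) : c.shift (c.opp l) = -c.shift l := by
  have h := c.mate_mate (0, l)
  rw [c.mate_mk 0, mate_mk] at h
  have := congrArg Prod.fst h
  simp only at this
  omega

/-- An arc that joined a marked point to itself would have a lift with shift `0`. -/
theorem opp_ne (l : L) : c.opp l ≠ l := by
  intro h
  have h1 := c.shift_opp l
  rw [h] at h1
  apply c.mate_ne (0, l)
  rw [mate_mk, h, show c.shift l = 0 by omega, add_zero]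

theorem opp_involutive : Function.Involutive c.opp := c.opp_opp

theorem mate_involutive : Function.Involutive c.mate := c.mate_mate

theorem ext_shift_opp {c c' : Connection pos} (hs : ∀ l, c.shift l = c'.shift l)
    (ho : ∀ l, c.opp l = c'.opp l) : c = c' := by
  ext1
  funext ⟨k, l⟩
  rw [mate_mk, mate_mk, hs, ho]

/-- The matchings of the marked points by two connections. -/
def oppPair (c : Connection pos) (c' : Connection pos') : MatchingPair L where
  f := c.opp_involutive.toPerm
  g := c'.opp_involutive.toPerm
  f_f := c.opp_opp
  g_g := c'.opp_opp
  f_ne := c.opp_ne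
  g_ne := c'.opp_ne

/-- The matchings of the lifts of the marked points by two connections. -/
def coverPair (c : Connection pos) (c' : Connection pos') : MatchingPair (ℤ × L) where
  f := c.mate_involutive.toPerm
  g := c'.mate_involutive.toPerm
  f_f := c.mate_mate
  g_g := c'.mate_mate
  f_ne := c.mate_ne
  g_ne := c'.mate_ne

/-- A connection from its matching of the marked points and the shifts along the arcs. -/
def ofShift (opp : L → L) (shift : L → ℤ) (opp_opp : ∀ l, opp (opp l) = l)
    (shift_opp : ∀ l, shift (opp l) = -shift l) (opp_ne : ∀ l, opp l ≠ l)
    (noncrossing : ∀ (k k' : ℤ) (l l' : L), ¬ (pos (k, l) < pos (k', l') ∧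
      pos (k', l') < pos (k + shift l, opp l) ∧
      pos (k + shift l, opp l) < pos (k' + shift l', opp l'))) : Connection pos where
  mate p := (p.1 + shift p.2, opp p.2)
  mate_ne p h := opp_ne p.2 (congrArg Prod.snd h)
  mate_mate p := by
    ext1
    · simp only [shift_opp]; omega
    · exact opp_opp _
  mate_deck k l := by
    ext1
    · simp only; omega
    · rfl
  noncrossing p q := noncrossing p.1 q.1 p.2 q.2

end Connection

/-- The total shift along the first `2 n` arcs of the curve that starts at `x`, when `s` and `t` are
the shifts along the arcs of the two matchings. -/
def MatchingPair.windingSum {X : Type} (D : MatchingPair X) (s t : X → ℤ) (n : ℕ) (x : X) : ℤ :=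
  ∑ i ∈ Finset.range n, (s ((D.turn ^ i) x) + t (D.f ((D.turn ^ i) x)))

/-- The winding number of the closed curve through `x`. -/
noncomputable def MatchingPair.winding {X : Type} (D : MatchingPair X) (s t : X → ℤ) (x : X) : ℤ :=
  D.windingSum s t (D.period x) x

theorem Connection.coverPair_turn_pow {L : Type} {pos pos' : ℤ × L → StripBoundary}
    (c : Connection pos) (c' : Connection pos') (n : ℕ) (k : ℤ) (l : L) :
    ((c.coverPair c').turn ^ n) (k, l) =
      (k + (c.oppPair c').windingSum c.shift c'.shift n l, ((c.oppPair c').turn ^ n) l) := by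
  induction n with
  | zero => simp [MatchingPair.windingSum]
  | succ n ih =>
    rw [← MatchingPair.turn_turn_pow, ← MatchingPair.turn_turn_pow, ih]
    change c'.mate (c.mate _) = (_, c'.opp (c.opp _))
    rw [c.mate_mk (k + _), Connection.mate_mk, MatchingPair.windingSum,
      MatchingPair.windingSum, Finset.sum_range_succ]
    ext1
    · simp only [← add_assoc]; rfl
    · rfl

theorem Connection.orbit_deck {L : Type} {pos pos' : ℤ × L → StripBoundary}
    {c : Connection pos} {c' : Connection pos'} {p q : ℤ × L} (h : (c.coverPair c').Orbit p q)
    (t : ℤ) : (c.coverPair c').Orbit (p.1 + t, p.2) (q.1 + t, q.2) := by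
  induction h with
  | rel x y h =>
    obtain ⟨k, l⟩ := x
    refine Relation.EqvGen.rel _ _ ?_
    rcases h with rfl | rfl
    · left
      change _ = c.mate _
      rw [Connection.mate_mk]
      change ((c.mate (k, l)).1 + t, (c.mate (k, l)).2) = _
      rw [Connection.mate_mk]
      ext1 <;> simp only; omega
    · right
      change _ = c'.mate _
      rw [Connection.mate_mk]
      change ((c'.mate (k, l)).1 + t, (c'.mate (k, l)).2) = _
      rw [Connection.mate_mk]
      ext1 <;> simp only; omega
  | refl x => exact MatchingPair.Orbit.refl _
  | symm x y _ ih => exact ih.symm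
  | trans x y z _ _ ih ih' => exact ih.trans ih'

/-- Two lifts of a marked point lie on the same lift of a curve when the deck transformation between
them is a power of the one that belongs to the curve. -/
theorem Connection.orbit_cover_iff {L : Type} {pos pos' : ℤ × L → StripBoundary}
    (c : Connection pos) (c' : Connection pos') (k : ℤ) (l : L) :
    (c.coverPair c').Orbit (0, l) (k, l) ↔
      ∃ j : ℤ, k = j * (c.oppPair c').winding c.shift c'.shift l := by
  have h := MatchingPair.orbit_fiber (D := c.coverPair c') (E := c.oppPair c') (π := Prod.snd)
    (fun x => by change (c.mate (x.1, x.2)).2 = _; rw [c.mate_mk]; rfl)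
    (fun x => by change (c'.mate (x.1, x.2)).2 = _; rw [c'.mate_mk]; rfl)
    (x := (0, l)) (y := (k, l))
  simp only [and_true] at h
  rw [h]
  have e1 : ∀ m : ℤ, ((c.coverPair c').turn ^ (c.oppPair c').period l) (m, l) =
      (m + (c.oppPair c').winding c.shift c'.shift l, l) := by
    intro m
    rw [c.coverPair_turn_pow, MatchingPair.turn_pow_period, MatchingPair.winding]
  have e2 : ∀ j : ℤ, (((c.coverPair c').turn ^ (c.oppPair c').period l) ^ j) (0, l) =
      (j * (c.oppPair c').winding c.shift c'.shift l, l) := by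
    intro j
    induction j using Int.induction_on with
    | zero => simp
    | succ i ih =>
      rw [add_comm, zpow_one_add, Equiv.Perm.mul_apply, ih, e1]
      congr 1; ring
    | pred i ih =>
      rw [sub_eq_neg_add, zpow_add, zpow_neg_one, Equiv.Perm.mul_apply, ih, Equiv.Perm.inv_eq_iff_eq,
        e1]
      congr 1; ring
  simp only [e2, Prod.mk.injEq, and_true]

/-! ### Curves in the annulus wind around it at most once -/

/-- The position of a lift of an outer marked point, when there is just one boundary line. -/
def linePos (N : ℕ) : ℤ × Fin N → StripBoundary
  | (k, l) => toLex (0, toLex (k, (l : ℤ)))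

/-- The number of a point on the boundary line, counted from a base point. -/
def height {N : ℕ} (p : ℤ × Fin N) : ℤ := N * p.1 + (p.2 : ℤ)

theorem height_lt_iff {N : ℕ} (p q : ℤ × Fin N) :
    height p < height q ↔ p.1 < q.1 ∨ p.1 = q.1 ∧ p.2 < q.2 := by
  obtain ⟨k, l⟩ := p
  obtain ⟨k', l'⟩ := q
  have := l.2
  have := l'.2
  simp only [height, Fin.lt_def]
  rcases lt_trichotomy k k' with h | rfl | h
  · have : (N : ℤ) * (k + 1) ≤ N * k' := mul_le_mul_of_nonneg_left (by omega) (by omega)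
    rw [mul_add] at this
    constructor <;> intros <;> omega
  · constructor <;> intros <;> omega
  · have : (N : ℤ) * (k' + 1) ≤ N * k := mul_le_mul_of_nonneg_left (by omega) (by omega)
    rw [mul_add] at this
    constructor <;> intros <;> omega

theorem linePos_lt_iff {N : ℕ} (p q : ℤ × Fin N) :
    linePos N p < linePos N q ↔ p.1 < q.1 ∨ p.1 = q.1 ∧ p.2 < q.2 := by
  obtain ⟨k, l⟩ := p
  obtain ⟨k', l'⟩ := q
  simp only [linePos, Prod.Lex.toLex_lt_toLex, lt_irrefl, false_or, true_and, Fin.lt_def]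
  omega

theorem height_injective {N : ℕ} : Function.Injective (height (N := N)) := by
  intro p q h
  have h1 := (height_lt_iff p q).not.1 (by omega)
  have h2 := (height_lt_iff q p).not.1 (by omega)
  have e1 : p.1 = q.1 := by
    by_contra hne
    omega
  refine Prod.ext e1 (le_antisymm ?_ ?_)
  · by_contra hlt
    exact h2 (Or.inr ⟨e1.symm, not_le.1 hlt⟩)
  · by_contra hlt
    exact h1 (Or.inr ⟨e1, not_le.1 hlt⟩)

section Winding

variable {N : ℕ}

theorem noncrossing_height (c : Connection (linePos N)) (p q : ℤ × Fin N) :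
    ¬ (height p < height q ∧ height q < height (c.mate p) ∧
      height (c.mate p) < height (c.mate q)) := by
  simp only [height_lt_iff, ← linePos_lt_iff]
  exact c.noncrossing p q

/-- If an arc passes over one end of a disjoint arc, then it passes over the other end as well. -/
theorem separates_iff (c : Connection (linePos N)) {p y : ℤ × Fin N} (h : p ≠ y)
    (h' : p ≠ c.mate y) :
    ((height y ≤ height p ↔ height y ≤ height (c.mate p)) ↔
      (height (c.mate y) ≤ height p ↔ height (c.mate y) ≤ height (c.mate p))) := by
  have a1 := noncrossing_height c p y
  have a2 := noncrossing_height c y p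
  have a3 := noncrossing_height c (c.mate p) y
  have a4 := noncrossing_height c (c.mate y) p
  have a5 := noncrossing_height c p (c.mate y)
  have a6 := noncrossing_height c y (c.mate p)
  have a7 := noncrossing_height c (c.mate p) (c.mate y)
  have a8 := noncrossing_height c (c.mate y) (c.mate p)
  simp only [c.mate_mate] at a1 a2 a3 a4 a5 a6 a7 a8
  have b1 : height p ≠ height y := fun e => h (height_injective e)
  have b2 : height p ≠ height (c.mate y) := fun e => h' (height_injective e)
  have b3 : height (c.mate p) ≠ height y := fun e => h' (by
    rw [← height_injective e, c.mate_mate])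
  have b4 : height (c.mate p) ≠ height (c.mate y) := fun e => h (by
    rw [← c.mate_mate p, height_injective e, c.mate_mate])
  have b5 : height y ≠ height (c.mate y) := fun e => c.mate_ne y (height_injective e).symm
  have b6 : height p ≠ height (c.mate p) := fun e => c.mate_ne p (height_injective e).symm
  clear h h'
  generalize height p = P at *
  generalize height y = Y at *
  generalize height (c.mate p) = P' at *
  generalize height (c.mate y) = Y' at *
  omega

/-- An arc does not pass over the ends of a disjoint arc that is at least as long. -/
theorem not_separates_of_maximal (c : Connection (linePos N)) {p y : ℤ × Fin N} (h : p ≠ y)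
    (h' : p ≠ c.mate y)
    (hmax : |height (c.mate p) - height p| ≤ |height (c.mate y) - height y|) :
    height y ≤ height p ↔ height y ≤ height (c.mate p) := by
  have a0 := separates_iff c h h'
  have b1 : height p ≠ height y := fun e => h (height_injective e)
  have b2 : height p ≠ height (c.mate y) := fun e => h' (height_injective e)
  have b3 : height (c.mate p) ≠ height y := fun e => h' (by
    rw [← height_injective e, c.mate_mate])
  have b4 : height (c.mate p) ≠ height (c.mate y) := fun e => h (by
    rw [← c.mate_mate p, height_injective e, c.mate_mate])
  clear h h'
  generalize height p = P at *
  generalize height y = Y at *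
  generalize height (c.mate p) = P' at *
  generalize height (c.mate y) = Y' at *
  rw [Int.abs_eq_natAbs, Int.abs_eq_natAbs] at hmax
  omega

theorem length_deck (c : Connection (linePos N)) (k t : ℤ) (l : Fin N) :
    |height (c.mate (k + t, l)) - height (k + t, l)| =
      |height (c.mate (k, l)) - height (k, l)| := by
  rw [c.mate_mk, c.mate_mk]
  simp only [height]
  congr 1
  ring

/-- Whether a point of the line is to the right of `h`, modulo `2`. -/
def rightOf (h : ℤ) (p : ℤ × Fin N) : ZMod 2 := if h ≤ height p then 1 else 0

theorem rightOf_add_eq {h h' : ℤ} {p q : ℤ × Fin N}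
    (hiff : (h ≤ height p ↔ h ≤ height q) ↔ (h' ≤ height p ↔ h' ≤ height q)) :
    rightOf h p + rightOf h q = rightOf h' p + rightOf h' q := by
  have h2 : (1 : ZMod 2) + 1 = 0 := by decide
  simp only [rightOf]
  split_ifs <;> simp_all

theorem rightOf_add_eq_zero {h : ℤ} {p q : ℤ × Fin N} (hiff : h ≤ height p ↔ h ≤ height q) :
    rightOf h p + rightOf h q = 0 := by
  have h2 : (1 : ZMod 2) + 1 = 0 := by decide
  simp only [rightOf]
  split_ifs <;> simp_all

open Filter in
/-- A lift of an essential closed curve in the annulus is invariant under the generator of the deck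
group. Otherwise it is disjoint from its translate. Modulo `2`, the number of its upper arcs over a
point and the number of its lower arcs below this point have sum `1`, and the first number is
constant along the translate. But the first number is `0` at the end of a longest upper arc of the
translate, and the second one is `0` at the end of a longest lower arc. -/
theorem orbit_translate (c c' : Connection (linePos N)) (v : Fin N) (P : ℕ) (W : ℤ) (hW : W ≠ 0)
    (hP : ∀ k, ((c.coverPair c').turn ^ P) (k, v) = (k + W, v)) :
    (c.coverPair c').Orbit (0, v) (1, v) := by
  by_contra hno
  set D := c.coverPair c' with hD
  -- the curve is disjoint from its translate
  have hdisj : ∀ (k : ℤ) (u : Fin N), D.Orbit (0, v) (k, u) → ¬ D.Orbit (0, v) (k + 1, u) := by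
    intro k u h h'
    have h1 := Connection.orbit_deck h 1
    exact hno (h'.trans (by simpa using h1.symm))
  have hmax : ∀ d : Connection (linePos N), ∃ (k : ℤ) (u : Fin N), D.Orbit (0, v) (k, u) ∧
      ∀ z, D.Orbit (0, v) z →
        |height (d.mate z) - height z| ≤ |height (d.mate (k + 1, u)) - height (k + 1, u)| := by
    intro d
    obtain ⟨u, ⟨k, hk⟩, hu⟩ := Set.exists_max_image {u : Fin N | ∃ k, D.Orbit (0, v) (k, u)}
      (fun u => |height (d.mate (0, u)) - height (0, u)|) (Set.toFinite _)
      ⟨v, 0, MatchingPair.Orbit.refl _⟩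
    refine ⟨k, u, hk, ?_⟩
    rintro ⟨m, w⟩ hz
    have h1 := hu w ⟨m, hz⟩
    have h2 := length_deck d 0 m w
    have h3 := length_deck d 0 (k + 1) u
    rw [zero_add] at h2 h3
    rw [h2, h3]
    exact h1
  obtain ⟨k₁, u₁, hx₁, hx₁m⟩ := hmax c
  obtain ⟨k₂, u₂, hx₂, hx₂m⟩ := hmax c'
  have hy₁ := hdisj _ _ hx₁
  have hy₂ := hdisj _ _ hx₂
  have h12 : D.Orbit (k₁ + 1, u₁) (k₂ + 1, u₂) :=
    Connection.orbit_deck (hx₁.symm.trans hx₂) 1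
  have hPm : ∀ (m : ℕ) (k : ℤ), (D.turn ^ (m * P)) (k, v) = (k + m * W, v) := by
    intro m
    induction m with
    | zero => intro k; simp
    | succ m ih =>
      intro k
      rw [add_mul, one_mul, pow_add, Equiv.Perm.mul_apply, hP, ih]
      congr 1; push_cast; ring
  -- `z j` runs along the curve from the translate by `-j W` of its point `v` to the translate by
  -- `j W`, and `F j h` and `G j h` count the arcs of the two kinds on this section that pass over `h`
  let z : ℕ → ℕ → ℤ × Fin N := fun j i => (D.turn ^ i) (-(j * W), v)
  let F : ℕ → ℤ → ZMod 2 := fun j h =>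
    ∑ i ∈ Finset.range (2 * j * P), (rightOf h (z j i) + rightOf h (c.mate (z j i)))
  let G : ℕ → ℤ → ZMod 2 := fun j h =>
    ∑ i ∈ Finset.range (2 * j * P), (rightOf h (c.mate (z j i)) + rightOf h (z j (i + 1)))
  have hz0 : ∀ j : ℕ, D.Orbit (0, v) (-(j * W), v) := by
    intro j
    have h1 := MatchingPair.orbit_turn_pow (D := D) (-(j * W), v) (j * P)
    rw [hPm, neg_add_cancel] at h1
    exact h1.symm
  have hz : ∀ j i, D.Orbit (0, v) (z j i) := fun j i =>
    (hz0 j).trans (MatchingPair.orbit_turn_pow _ _)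
  have hzc : ∀ j i, D.Orbit (0, v) (c.mate (z j i)) := fun j i =>
    (hz j i).trans (MatchingPair.orbit_f (D := D) _)
  have hzs : ∀ j i, z j (i + 1) = c'.mate (c.mate (z j i)) := fun j i => by
    change (D.turn ^ (i + 1)) _ = _
    rw [← MatchingPair.turn_turn_pow]
    rfl
  have hFG : ∀ h, ∀ᶠ j in atTop, F j h + G j h = 1 := by
    intro h
    have hN : (0 : ℤ) < N := by have := v.2; omega
    filter_upwards [eventually_ge_atTop (h.natAbs + N + 1)] with j hj
    -- the section leads from one side of `h` to the other
    have hsum : F j h + G j h = rightOf h (z j (2 * j * P)) - rightOf h (z j 0) := by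
      rw [← Finset.sum_range_sub (fun i => rightOf h (z j i)), ← Finset.sum_add_distrib]
      refine Finset.sum_congr rfl fun i _ => ?_
      have e : ∀ a b d : ZMod 2, a + b + (b + d) = d - a := by decide
      exact e _ _ _
    rw [hsum]
    have e1 : z j (2 * j * P) = (j * W, v) := by
      change (D.turn ^ (2 * j * P)) _ = _
      rw [hPm]
      congr 1; push_cast; ring
    have e0 : z j 0 = (-(j * W), v) := rfl
    rw [e1, e0]
    have hv := v.2
    have hj' : |h| + N + 1 ≤ (j : ℤ) := by rw [Int.abs_eq_natAbs]; omega
    have hjW : (j : ℤ) ≤ j * |W| := le_mul_of_one_le_right (by omega) (Int.one_le_abs hW)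
    have hjN : (j : ℤ) * |W| ≤ N * (j * |W|) := le_mul_of_one_le_left (by positivity) (by omega)
    have hlo := neg_abs_le h
    have hhi := le_abs_self h
    have hneg : height (-(j * W), v) = -(N * (j * W)) + v := by simp only [height]; ring
    have hpos : height (j * W, v) = N * (j * W) + v := rfl
    rw [rightOf, rightOf]
    rcases abs_cases W with ⟨hWa, -⟩ | ⟨hWa, -⟩
    · rw [hWa] at hjW hjN
      rw [if_pos (by omega), if_neg (by omega)]
      decide
    · rw [hWa] at hjW hjN
      have e3 : (N : ℤ) * (j * -W) = -(N * (j * W)) := by ring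
      rw [e3] at hjN
      rw [if_neg (by omega), if_pos (by omega)]
      decide
  -- the two counts are constant along arcs of the same kind that are disjoint from the curve
  have hFc : ∀ y, ¬ D.Orbit (0, v) y → ∀ j, F j (height y) = F j (height (c.mate y)) := by
    intro y hy j
    refine Finset.sum_congr rfl fun i _ => rightOf_add_eq (separates_iff c ?_ ?_)
    · rintro rfl; exact hy (hz j i)
    · intro h
      exact hy ((hz j i).trans (by rw [h]; exact (MatchingPair.orbit_f (D := D) y).symm))
  have hGc : ∀ y, ¬ D.Orbit (0, v) y → ∀ j, G j (height y) = G j (height (c'.mate y)) := by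
    intro y hy j
    refine Finset.sum_congr rfl fun i _ => ?_
    rw [hzs]
    refine rightOf_add_eq (separates_iff c' ?_ ?_)
    · rintro rfl; exact hy (hzc j i)
    · intro h
      exact hy ((hzc j i).trans (by rw [h]; exact (MatchingPair.orbit_g (D := D) y).symm))
  have hF : ∀ x y, D.Orbit x y → ¬ D.Orbit (0, v) x →
      ∀ᶠ j in atTop, F j (height x) = F j (height y) := by
    intro x y hxy
    induction hxy with
    | rel x y h =>
      intro hx
      rcases h with rfl | rfl
      · exact Eventually.of_forall (hFc x hx)
      · filter_upwards [hFG (height x), hFG (height (D.g x))] with j h1 h2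
        have h3 := hGc x hx j
        change G j (height x) = G j (height (D.g x)) at h3
        rw [← h3, ← h1] at h2
        exact (add_right_cancel h2).symm
    | refl x => exact fun _ => Eventually.of_forall fun _ => rfl
    | symm x y h ih =>
      intro hy
      filter_upwards [ih fun hx => hy (hx.trans h)] with j hj using hj.symm
    | trans x y w h h' ih ih' =>
      intro hx
      filter_upwards [ih hx, ih' fun hy => hx (hy.trans (MatchingPair.Orbit.symm h))] with j h1 h2
      exact h1.trans h2
  obtain ⟨j, hj1, hj2⟩ := ((hF _ _ h12 hy₁).and (hFG (height (k₂ + 1, u₂)))).exists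
  have e1 : F j (height (k₁ + 1, u₁)) = 0 := by
    refine Finset.sum_eq_zero fun i _ => rightOf_add_eq_zero ?_
    refine not_separates_of_maximal c ?_ ?_ (hx₁m _ (hz j i))
    · intro h; exact hy₁ (h ▸ hz j i)
    · intro h
      exact hy₁ ((hz j i).trans (by rw [h]; exact (MatchingPair.orbit_f (D := D) _).symm))
  have e2 : G j (height (k₂ + 1, u₂)) = 0 := by
    refine Finset.sum_eq_zero fun i _ => ?_
    rw [hzs]
    refine rightOf_add_eq_zero (not_separates_of_maximal c' ?_ ?_ (hx₂m _ (hzc j i)))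
    · intro h; exact hy₂ (h ▸ hzc j i)
    · intro h
      exact hy₂ ((hzc j i).trans (by rw [h]; exact (MatchingPair.orbit_g (D := D) _).symm))
  rw [← hj1, e1, e2] at hj2
  exact absurd hj2 (by decide)

/-- A closed curve that is formed by two connections in an annulus winds around it at most once: the
shift of one turn divides all shifts between lifts that lie on one curve, and by `orbit_translate`
the shift `1` is among them unless the winding number is `0`. -/
theorem winding_mem (c c' : Connection (linePos N)) (v : Fin N) :
    (c.oppPair c').winding c.shift c'.shift v = 0 ∨
    (c.oppPair c').winding c.shift c'.shift v = 1 ∨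
    (c.oppPair c').winding c.shift c'.shift v = -1 := by
  by_cases hW : (c.oppPair c').winding c.shift c'.shift v = 0
  · exact Or.inl hW
  · right
    have h := orbit_translate c c' v ((c.oppPair c').period v) _ hW fun k => by
      rw [c.coverPair_turn_pow, MatchingPair.turn_pow_period, MatchingPair.winding]
    rw [c.orbit_cover_iff] at h
    obtain ⟨j, hj⟩ := h
    exact Int.isUnit_iff.1 (IsUnit.of_mul_eq_one j (by rw [mul_comm]; exact hj.symm))

end Winding

/-! ### The arc that intersects the crosscap -/

/-- The ends of the arcs that intersect the crosscap. -/
def crossing {n : ℕ} (m : MbDiagram n) : Set (Fin (2 * n)) := {l | Odd (m.shift l)}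

theorem mbPos_lt_iff {N : ℕ} (k k' : ℤ) (l l' : Fin N) :
    mbPos N (k, l) < mbPos N (k', l') ↔
      (k % 2 = 0 ∧ k' % 2 = 1) ∨
      (k % 2 = 0 ∧ k' % 2 = 0 ∧ (k < k' ∨ k = k' ∧ (l : ℕ) < l')) ∨
      (k % 2 = 1 ∧ k' % 2 = 1 ∧ (k' < k ∨ k = k' ∧ (l' : ℕ) < l)) := by
  have e : (Even k ∧ k % 2 = 0) ∨ (¬ Even k ∧ k % 2 = 1) := by rw [Int.even_iff]; omega
  have e' : (Even k' ∧ k' % 2 = 0) ∨ (¬ Even k' ∧ k' % 2 = 1) := by rw [Int.even_iff]; omega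
  rcases e with ⟨h, e⟩ | ⟨h, e⟩ <;> rcases e' with ⟨h', e'⟩ | ⟨h', e'⟩ <;>
    simp [mbPos, h, h', e, e', Prod.Lex.toLex_lt_toLex]

section Mobius

variable {n : ℕ} {m : MbDiagram n}

theorem shift_mod_two (m : MbDiagram n) (l : Fin (2 * n)) :
    (l ∈ crossing m ∧ m.shift l % 2 = 1) ∨ (l ∉ crossing m ∧ m.shift l % 2 = 0) := by
  simp only [crossing, Set.mem_ofPred_eq, Int.odd_iff]
  omega

theorem opp_mem_crossing {l : Fin (2 * n)} (h : l ∈ crossing m) : m.opp l ∈ crossing m := by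
  change Odd _
  rw [m.shift_opp]
  exact Odd.neg h

theorem crosscapEnds_eq (m : MbDiagram n) : crosscapEnds m = (crossing m).ncard := rfl

theorem isMb0_iff : IsMb0 m ↔ crossing m = ∅ := by
  rw [IsMb0, crosscapEnds_eq, Set.ncard_eq_zero]

theorem pair_ncard (m : MbDiagram n) (l : Fin (2 * n)) :
    ({l, m.opp l} : Set (Fin (2 * n))).ncard = 2 := Set.ncard_pair (m.opp_ne l).symm

theorem crossing_eq_pair (hm : IsMb0 m ∨ IsMb1 m) {l : Fin (2 * n)} (hl : l ∈ crossing m) :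
    crossing m = {l, m.opp l} := by
  have hsub : ({l, m.opp l} : Set (Fin (2 * n))) ⊆ crossing m := by
    rintro x (rfl | rfl)
    · exact hl
    · exact opp_mem_crossing hl
  refine (Set.eq_of_subset_of_ncard_le hsub ?_ (Set.toFinite _)).symm
  rw [pair_ncard]
  rcases hm with h | h
  · rw [isMb0_iff] at h; simp [h]
  · exact h.le

theorem isArcEnds_crossing (hm : IsMb0 m ∨ IsMb1 m) :
    MatchingPair.IsArcEnds m.opp (crossing m) := by
  refine ⟨fun x hx => opp_mem_crossing hx, fun x hx y hy => ?_⟩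
  rw [crossing_eq_pair hm hx] at hy
  exact hy

theorem shift_of_lt_opp {l : Fin (2 * n)} (hl : l ∈ crossing m) (hlt : (l : ℕ) < m.opp l) :
    m.shift l = -1 := by
  have hodd : m.shift l % 2 = 1 := Int.odd_iff.1 hl
  have h1 := m.noncrossing (0, l) (0, m.opp l)
  have h2 := m.noncrossing (-2, m.opp l) (0, l)
  simp only [m.mate_mk, m.opp_opp, m.shift_opp, mbPos_lt_iff, true_and] at h1 h2
  generalize m.shift l = s at *
  have h1' : s < 0 := by
    clear h2
    by_contra hs
    exact h1 ⟨by omega, by omega, by omega⟩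
  have h2' : -1 ≤ s := by
    clear h1
    by_contra hs
    exact h2 ⟨by omega, by omega, by omega⟩
  omega

/-- The arc that intersects the crosscap is unique up to isotopy once its ends are known. The lifts
of this arc are in order on both sides of the strip. -/
theorem shift_of_mem_crossing (m : MbDiagram n) {l : Fin (2 * n)} (hl : l ∈ crossing m) :
    (m.shift l = -1 ∧ (l : ℕ) < m.opp l) ∨ (m.shift l = 1 ∧ (m.opp l : ℕ) < l) := by
  rcases lt_trichotomy (l : ℕ) (m.opp l) with h | h | h
  · exact Or.inl ⟨shift_of_lt_opp hl h, h⟩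
  · exact absurd (Fin.ext h).symm (m.opp_ne l)
  · refine Or.inr ⟨?_, h⟩
    have h1 := shift_of_lt_opp (opp_mem_crossing hl) (by rwa [m.opp_opp])
    rw [m.shift_opp] at h1
    omega

/-- The shift of an arc after the arc that intersects the crosscap is replaced by an arc disjoint
from it. -/
def closeShift (ε : Bool) (s : ℤ) : ℤ := if s % 2 = 0 then s / 2 else if ε then s else 0

theorem closeShift_even {s : ℤ} (ε : Bool) (h : s % 2 = 0) : 2 * closeShift ε s = s := by
  rw [closeShift, if_pos h]; omega

theorem closeShift_false_odd {s : ℤ} (h : s % 2 = 1) : closeShift false s = 0 := by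
  rw [closeShift, if_neg (by omega)]; rfl

theorem closeShift_true_odd {s : ℤ} (h : s % 2 = 1) : closeShift true s = s := by
  rw [closeShift, if_neg (by omega)]; rfl

/-- The complement of the crosscap is an annulus. The arc that intersects the crosscap, if there is
one, is replaced by one of the two arcs in this annulus which have the same ends and are close to the
union of this arc with the crosscap: for `ε = false` by the arc that is disjoint from the base
point, and for `ε = true` by the arc that passes it. -/
def closeUp (m : MbDiagram n) (hm : IsMb0 m ∨ IsMb1 m) (ε : Bool) :
    Connection (linePos (2 * n)) :=
  Connection.ofShift m.opp (fun l => closeShift ε (m.shift l)) m.opp_opp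
    (fun l => by
      rw [m.shift_opp]
      simp only [closeShift]
      cases ε <;> simp only [Bool.false_eq_true, if_true, if_false] <;> split_ifs <;> omega)
    m.opp_ne
    (by
      rintro k k' l l' ⟨h1, h2, h3⟩
      rw [linePos_lt_iff] at h1 h2 h3
      simp only [Fin.lt_def] at h1 h2 h3
      rcases shift_mod_two m l with ⟨hl, hs⟩ | ⟨hl, hs⟩ <;>
        rcases shift_mod_two m l' with ⟨hl', hs'⟩ | ⟨hl', hs'⟩
      · have a := shift_of_mem_crossing m hl
        have a' := shift_of_mem_crossing m hl'
        have e : closeShift ε (m.shift l) = 0 ∨ closeShift ε (m.shift l) = m.shift l := by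
          cases ε
          · exact Or.inl (closeShift_false_odd hs)
          · exact Or.inr (closeShift_true_odd hs)
        rcases (isArcEnds_crossing hm).2 l hl l' hl' with rfl | rfl
        · omega
        · rw [m.opp_opp] at h3 a'
          omega
      · have e' := closeShift_even ε hs'
        have h := m.noncrossing (2 * k', l') (2 * (k + closeShift ε (m.shift l)), m.opp l)
        simp only [m.mate_mk, m.opp_opp, m.shift_opp, mbPos_lt_iff] at h
        omega
      · have e := closeShift_even ε hs
        have h := m.noncrossing (2 * k, l) (2 * k', l')
        simp only [m.mate_mk, mbPos_lt_iff] at h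
        omega
      · have e := closeShift_even ε hs
        have e' := closeShift_even ε hs'
        have h := m.noncrossing (2 * k, l) (2 * k', l')
        simp only [m.mate_mk, mbPos_lt_iff] at h
        omega)

theorem closeUp_opp (hm : IsMb0 m ∨ IsMb1 m) (ε : Bool) (l : Fin (2 * n)) :
    (closeUp m hm ε).opp l = m.opp l := rfl

theorem closeUp_shift (hm : IsMb0 m ∨ IsMb1 m) (ε : Bool) (l : Fin (2 * n)) :
    (closeUp m hm ε).shift l = closeShift ε (m.shift l) := by
  change 0 + _ = _
  rw [zero_add]

end Mobius

/-! ### Closed curves in the Klein bottle -/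

theorem fromRel_reachable_iff {X : Type} {r : X → X → Prop} {x y : X} :
    (SimpleGraph.fromRel r).Reachable x y ↔ Relation.EqvGen r x y := by
  constructor
  · rintro ⟨p⟩
    induction p with
    | nil => exact Relation.EqvGen.refl _
    | cons h _ ih =>
      refine Relation.EqvGen.trans _ _ _ ?_ ih
      rcases h.2 with h | h
      · exact Relation.EqvGen.rel _ _ h
      · exact Relation.EqvGen.symm _ _ (Relation.EqvGen.rel _ _ h)
  · intro h
    induction h with
    | rel x y h =>
      by_cases hxy : x = y
      · rw [hxy]
      · exact SimpleGraph.Adj.reachable ⟨hxy, Or.inl h⟩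
    | refl x => exact SimpleGraph.Reachable.refl _
    | symm x y _ ih => exact ih.symm
    | trans x y z _ _ ih ih' => exact ih.trans ih'

/-- The loops in the Klein bottle that belong to the labels. -/
def curveLoop : CurveVar → KleinGroup
  | .d => 1
  | .x => coreA
  | .y => coreB
  | .z => coreA ^ 2
  | .w => coreA * coreB⁻¹

theorem coreA_sq : coreA ^ 2 = coreB ^ 2 := by
  have h : (PresentedGroup.mk ({FreeGroup.of 0 ^ 2 * (FreeGroup.of 1 ^ 2)⁻¹} :
      Set (FreeGroup (Fin 2)))) (FreeGroup.of 0 ^ 2 * (FreeGroup.of 1 ^ 2)⁻¹) = 1 :=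
    PresentedGroup.one_of_mem (Set.mem_singleton _)
  rw [map_mul, map_inv, map_pow, map_pow, mul_inv_eq_one] at h
  exact h

theorem commute_coreA (g : ℤ) (k : ℤ) : Commute ((coreA ^ 2) ^ g) (coreA ^ k) :=
  (((Commute.refl coreA).pow_left 2).zpow_left g).zpow_right k

theorem commute_coreB (g : ℤ) (k : ℤ) : Commute ((coreA ^ 2) ^ g) (coreB ^ k) := by
  rw [coreA_sq]
  exact (((Commute.refl coreB).pow_left 2).zpow_left g).zpow_right k

/-- The abelianization of the fundamental group of the Klein bottle. -/
def kleinAb : KleinGroup →* Multiplicative (ℤ × ZMod 2) :=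
  PresentedGroup.toGroup (f := ![Multiplicative.ofAdd (1, 1), Multiplicative.ofAdd (1, 0)]) (by
    intro r hr
    rw [Set.mem_singleton_iff] at hr
    subst hr
    simp only [map_mul, map_inv, map_pow, FreeGroup.lift_apply_of]
    decide)

theorem kleinAb_coreA : kleinAb coreA = Multiplicative.ofAdd (1, 1) :=
  PresentedGroup.toGroup.of _

theorem kleinAb_coreB : kleinAb coreB = Multiplicative.ofAdd (1, 0) :=
  PresentedGroup.toGroup.of _

theorem toAdd_kleinAb_curveLoop (s : CurveVar) :
    (kleinAb (curveLoop s)).toAdd = match s with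
      | .d => (0, 0)
      | .x => (1, 1)
      | .y => (1, 0)
      | .z => (2, 0)
      | .w => (0, 1) := by
  cases s <;> simp only [curveLoop, map_one, map_mul, map_inv, map_pow, kleinAb_coreA,
    kleinAb_coreB] <;> rfl

/-- The labels are determined by the subgroups that their loops generate in the abelianization. -/
theorem curveVar_eq {s t : CurveVar} {j k : ℤ}
    (h : kleinAb (curveLoop t) = kleinAb (curveLoop s) ^ j)
    (h' : kleinAb (curveLoop s) = kleinAb (curveLoop t) ^ k) : s = t := by
  have e := congrArg Multiplicative.toAdd h
  have e' := congrArg Multiplicative.toAdd h'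
  rw [toAdd_zpow, toAdd_kleinAb_curveLoop, toAdd_kleinAb_curveLoop] at e e'
  have f1 := congrArg Prod.fst e
  have f2 := congrArg Prod.snd e
  have f1' := congrArg Prod.fst e'
  have f2' := congrArg Prod.snd e'
  clear e e' h h'
  cases s <;> cases t <;> simp at f1 f2 f1' f2' ⊢ <;> omega

variable {n : ℕ}

/-- The other end of the lifted arc that starts at `u`, when `a` is the core of the crosscap. -/
def kleinStep (a : KleinGroup) (m : MbDiagram n) (u : KleinGroup × Fin (2 * n)) :
    KleinGroup × Fin (2 * n) :=
  (u.1 * a ^ m.shift u.2, m.opp u.2)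

theorem kleinStep_involutive (a : KleinGroup) (m : MbDiagram n) :
    Function.Involutive (kleinStep a m) := fun u => by
  simp only [kleinStep, m.shift_opp, m.opp_opp, zpow_neg, mul_inv_cancel_right]

theorem kleinStep_ne (a : KleinGroup) (m : MbDiagram n) (u : KleinGroup × Fin (2 * n)) :
    kleinStep a m u ≠ u := fun h => m.opp_ne u.2 (congrArg Prod.snd h)

/-- The matchings of the lifts of the marked points to the universal cover of the Klein bottle. -/
def kleinPair (m₁ m₂ : MbDiagram n) : MatchingPair (KleinGroup × Fin (2 * n)) where
  f := (kleinStep_involutive coreA m₁).toPerm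
  g := (kleinStep_involutive coreB m₂).toPerm
  f_f := kleinStep_involutive coreA m₁
  g_g := kleinStep_involutive coreB m₂
  f_ne := kleinStep_ne coreA m₁
  g_ne := kleinStep_ne coreB m₂

theorem mbGlue_reachable_iff (m₁ m₂ : MbDiagram n) {i j : Fin (2 * n)} :
    (mbGlue m₁ m₂).Reachable i j ↔ (m₁.oppPair m₂).Orbit i j := fromRel_reachable_iff

theorem mbGlueCover_reachable_iff (m₁ m₂ : MbDiagram n) {u v : KleinGroup × Fin (2 * n)} :
    (mbGlueCover m₁ m₂).Reachable u v ↔ (kleinPair m₁ m₂).Orbit u v := fromRel_reachable_iff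

theorem kleinPair_orbit_mul {m₁ m₂ : MbDiagram n} {u v : KleinGroup × Fin (2 * n)}
    (h : (kleinPair m₁ m₂).Orbit u v) (c : KleinGroup) :
    (kleinPair m₁ m₂).Orbit (c * u.1, u.2) (c * v.1, v.2) := by
  induction h with
  | rel x y h =>
    refine Relation.EqvGen.rel _ _ ?_
    rcases h with rfl | rfl
    · exact Or.inl (Prod.ext (mul_assoc _ _ _).symm rfl)
    · exact Or.inr (Prod.ext (mul_assoc _ _ _).symm rfl)
  | refl x => exact MatchingPair.Orbit.refl _
  | symm x y _ ih => exact ih.symm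
  | trans x y z _ _ ih ih' => exact ih.trans ih'

theorem exists_kleinPair_orbit {m₁ m₂ : MbDiagram n} {i j : Fin (2 * n)}
    (h : (m₁.oppPair m₂).Orbit i j) :
    ∀ g : KleinGroup, ∃ g', (kleinPair m₁ m₂).Orbit (g, i) (g', j) := by
  induction h with
  | rel x y h =>
    intro g
    rcases h with rfl | rfl
    · exact ⟨_, MatchingPair.orbit_f (D := kleinPair m₁ m₂) (g, x)⟩
    · exact ⟨_, MatchingPair.orbit_g (D := kleinPair m₁ m₂) (g, x)⟩
  | refl x => exact fun g => ⟨g, MatchingPair.Orbit.refl _⟩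
  | symm x y _ ih =>
    intro g
    obtain ⟨g', hg'⟩ := ih 1
    refine ⟨g * g'⁻¹, ?_⟩
    have := (kleinPair_orbit_mul hg' (g * g'⁻¹)).symm
    simpa using this
  | trans x y z _ _ ih ih' =>
    intro g
    obtain ⟨g', hg'⟩ := ih g
    obtain ⟨g'', hg''⟩ := ih' g'
    exact ⟨g'', hg'.trans hg''⟩

/-- A closed curve has at most one label. -/
theorem isCurveOfClass_unique {m₁ m₂ : MbDiagram n} {C : (mbGlue m₁ m₂).ConnectedComponent}
    {s t : CurveVar} (hs : IsCurveOfClass m₁ m₂ C (curveLoop s))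
    (ht : IsCurveOfClass m₁ m₂ C (curveLoop t)) : s = t := by
  have key : ∀ s t, IsCurveOfClass m₁ m₂ C (curveLoop s) → IsCurveOfClass m₁ m₂ C (curveLoop t) →
      ∃ j : ℤ, kleinAb (curveLoop t) = kleinAb (curveLoop s) ^ j := by
    rintro s t ⟨i, hi, c, hc⟩ ⟨i', hi', c', hc'⟩
    have hii : (mbGlue m₁ m₂).Reachable i' i := by
      rw [← SimpleGraph.ConnectedComponent.eq]
      exact hi'.trans hi.symm
    rw [mbGlue_reachable_iff] at hii
    obtain ⟨q, hq⟩ := exists_kleinPair_orbit hii 1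
    have h1 : c' * curveLoop t * c'⁻¹ ∈ {h | (mbGlueCover m₁ m₂).Reachable (1, i') (h, i')} := by
      rw [hc']; exact Subgroup.mem_zpowers _
    rw [Set.mem_ofPred_eq, mbGlueCover_reachable_iff] at h1
    -- the stabilizers at two points of the curve are conjugate
    have h2 := kleinPair_orbit_mul ((hq.symm.trans h1).trans
      (kleinPair_orbit_mul hq (c' * curveLoop t * c'⁻¹) |> fun h => by simpa using h)) q⁻¹
    have h3 : q⁻¹ * (c' * curveLoop t * c'⁻¹ * q) ∈
        {h | (mbGlueCover m₁ m₂).Reachable (1, i) (h, i)} := by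
      rw [Set.mem_ofPred_eq, mbGlueCover_reachable_iff]
      simpa using h2
    rw [hc, SetLike.mem_coe, Subgroup.mem_zpowers_iff] at h3
    obtain ⟨j, hj⟩ := h3
    refine ⟨j, ?_⟩
    have h4 := congrArg kleinAb hj
    simp only [map_zpow, map_mul, map_inv] at h4
    rw [mul_inv_cancel_comm, mul_comm (kleinAb c' * _ * _), inv_mul_cancel_left,
      mul_inv_cancel_comm] at h4
    exact h4.symm
  obtain ⟨j, hj⟩ := key s t hs ht
  obtain ⟨k, hk⟩ := key t s ht hs
  exact curveVar_eq hj hk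

/-! ### The labels of closed curves in the Klein bottle -/

/-- The shift of an arc that intersects the crosscap, and `0` for other arcs. -/
def crossShift (s : ℤ) : ℤ := if s % 2 = 0 then 0 else s

theorem eq_closeShift_add (s : ℤ) : s = 2 * closeShift false s + crossShift s := by
  simp only [closeShift, crossShift, Bool.false_eq_true, if_false]
  split_ifs <;> omega

theorem closeShift_true (s : ℤ) : closeShift true s = closeShift false s + crossShift s := by
  simp only [closeShift, crossShift]
  split_ifs <;> simp_all

theorem crossShift_eq_zero {m : MbDiagram n} {l : Fin (2 * n)} (h : l ∉ crossing m) :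
    crossShift (m.shift l) = 0 := by
  rcases shift_mod_two m l with ⟨hl, hs⟩ | ⟨hl, hs⟩
  · exact absurd hl h
  · rw [crossShift, if_pos hs]

theorem crossShift_eq {m : MbDiagram n} {l : Fin (2 * n)} (h : l ∈ crossing m) :
    crossShift (m.shift l) = m.shift l := by
  rcases shift_mod_two m l with ⟨hl, hs⟩ | ⟨hl, hs⟩
  · rw [crossShift, if_neg (by omega)]
  · exact absurd h hl

theorem turn_kleinPair (m₁ m₂ : MbDiagram n) (u : KleinGroup × Fin (2 * n)) :
    (kleinPair m₁ m₂).turn u =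
      (u.1 * coreA ^ m₁.shift u.2 * coreB ^ m₂.shift (m₁.opp u.2), (m₁.oppPair m₂).turn u.2) :=
  rfl

/-- The element of the fundamental group that is picked up along the first `2 (k + 1)` arcs of the
curve through `v`. The powers of the central element `coreA ^ 2` are collected. The base point `v` is
chosen such that only the first arc can intersect the first crosscap. -/
theorem turn_kleinPair_pow {m₁ m₂ : MbDiagram n} (v : Fin (2 * n)) (k : ℕ)
    (h : ∀ i, 0 < i → i < k + 1 → ((m₁.oppPair m₂).turn ^ i) v ∉ crossing m₁) :
    ((kleinPair m₁ m₂).turn ^ (k + 1)) (1, v) =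
      ((coreA ^ 2) ^ (m₁.oppPair m₂).windingSum (fun l => closeShift false (m₁.shift l))
          (fun l => closeShift false (m₂.shift l)) (k + 1) v *
        (coreA ^ crossShift (m₁.shift v) *
          coreB ^ ∑ i ∈ Finset.range (k + 1),
            crossShift (m₂.shift (m₁.opp (((m₁.oppPair m₂).turn ^ i) v)))),
        ((m₁.oppPair m₂).turn ^ (k + 1)) v) := by
  have hA : ∀ s : ℤ, coreA ^ s = (coreA ^ 2) ^ closeShift false s * coreA ^ crossShift s := by
    intro s
    conv_lhs => rw [eq_closeShift_add s, zpow_add, zpow_mul]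
    rfl
  have hB : ∀ s : ℤ, coreB ^ s = (coreA ^ 2) ^ closeShift false s * coreB ^ crossShift s := by
    intro s
    conv_lhs => rw [eq_closeShift_add s, zpow_add, zpow_mul]
    rw [coreA_sq]
    rfl
  induction k with
  | zero =>
    rw [zero_add, pow_one, pow_one, turn_kleinPair]
    ext1
    · simp only [MatchingPair.windingSum, Finset.range_one, Finset.sum_singleton, pow_zero,
        Equiv.Perm.one_apply]
      change _ = (coreA ^ 2) ^ (_ + closeShift false (m₂.shift (m₁.opp v))) * _
      rw [one_mul, hA, hB (m₂.shift _), zpow_add]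
      simp only [mul_assoc]
      rw [← mul_assoc (coreA ^ _) ((coreA ^ 2) ^ _), (commute_coreA _ _).symm.eq, mul_assoc]
    · rfl
  | succ k ih =>
    rw [← MatchingPair.turn_turn_pow, ih fun i hi hik => h i hi (by omega), turn_kleinPair,
      MatchingPair.turn_turn_pow]
    ext1
    · simp only [MatchingPair.windingSum]
      rw [Finset.sum_range_succ _ (k + 1), Finset.sum_range_succ _ (k + 1)]
      set u := ((m₁.oppPair m₂).turn ^ (k + 1)) v with hu
      have hcross : crossShift (m₁.shift u) = 0 :=
        crossShift_eq_zero (h _ (by omega) (by omega))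
      change _ = (coreA ^ 2) ^ (_ + (_ + closeShift false (m₂.shift (m₁.opp u)))) * _
      rw [hA (m₁.shift u), hcross, zpow_zero, mul_one, hB (m₂.shift (m₁.opp u)), zpow_add, zpow_add,
        zpow_add, mul_assoc ((coreA ^ 2) ^ _ * _), ← mul_assoc ((coreA ^ 2) ^ _) ((coreA ^ 2) ^ _),
        ← zpow_add]
      generalize closeShift false (m₁.shift u) + closeShift false (m₂.shift (m₁.opp u)) = r
      simp only [mul_assoc]
      congr 1
      rw [← mul_assoc (coreB ^ _) ((coreA ^ 2) ^ _), (commute_coreB r _).symm.eq, mul_assoc,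
        ← mul_assoc (coreA ^ _) ((coreA ^ 2) ^ _), (commute_coreA r _).symm.eq, mul_assoc]
    · rfl

/-- The deck transformations which preserve a lift of a closed curve are the powers of the element
`H` that is picked up along one turn. -/
theorem kleinPair_stabilizer {m₁ m₂ : MbDiagram n} (v : Fin (2 * n)) (H : KleinGroup)
    (hH : ((kleinPair m₁ m₂).turn ^ (m₁.oppPair m₂).period v) (1, v) = (H, v)) :
    {h : KleinGroup | (mbGlueCover m₁ m₂).Reachable (1, v) (h, v)} =
      (Subgroup.zpowers H : Set KleinGroup) := by
  have e2 : ∀ (k : ℕ) (c g : KleinGroup) (l : Fin (2 * n)),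
      ((kleinPair m₁ m₂).turn ^ k) (c * g, l) =
        (c * (((kleinPair m₁ m₂).turn ^ k) (g, l)).1, (((kleinPair m₁ m₂).turn ^ k) (g, l)).2) := by
    intro k c g l
    induction k with
    | zero => rfl
    | succ k ih =>
      rw [← MatchingPair.turn_turn_pow, ← MatchingPair.turn_turn_pow, ih]
      refine Prod.ext ?_ rfl
      simp only [turn_kleinPair, mul_assoc]
  have e1 : ∀ g, ((kleinPair m₁ m₂).turn ^ (m₁.oppPair m₂).period v) (g, v) = (g * H, v) := by
    intro g
    have := e2 ((m₁.oppPair m₂).period v) g 1 v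
    rwa [mul_one, hH] at this
  have e3 : ∀ j : ℤ, (((kleinPair m₁ m₂).turn ^ (m₁.oppPair m₂).period v) ^ j) (1, v) =
      (H ^ j, v) := by
    intro j
    induction j using Int.induction_on with
    | zero => simp
    | succ i ih => rw [add_comm, zpow_one_add, Equiv.Perm.mul_apply, ih, e1, add_comm, zpow_add_one]
    | pred i ih =>
      rw [sub_eq_neg_add, zpow_add, zpow_neg_one, Equiv.Perm.mul_apply, ih, Equiv.Perm.inv_eq_iff_eq,
        e1, ← zpow_add_one]
      congr 2; ring
  ext h
  rw [Set.mem_ofPred_eq, mbGlueCover_reachable_iff, SetLike.mem_coe, Subgroup.mem_zpowers_iff]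
  have key := MatchingPair.orbit_fiber (D := kleinPair m₁ m₂) (E := m₁.oppPair m₂) (π := Prod.snd)
    (fun x => rfl) (fun x => rfl) (x := (1, v)) (y := (h, v))
  simp only [and_true] at key
  rw [key]
  simp only [e3, Prod.mk.injEq, and_true]
  exact exists_congr fun j => eq_comm

/-- The winding number, in the annulus, of the curve through `v` after the arcs that intersect the
crosscaps have been replaced by arcs disjoint from the base point. -/
noncomputable def closedWinding (m₁ m₂ : MbDiagram n) (v : Fin (2 * n)) : ℤ :=
  (m₁.oppPair m₂).winding (fun l => closeShift false (m₁.shift l))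
    (fun l => closeShift false (m₂.shift l)) v

/-- When another pair of arcs in the annulus replaces the arcs that intersect the crosscaps, the
winding number changes by the number of passages through the crosscaps, counted with signs. All these
winding numbers are `0` or `±1`. -/
theorem closedWinding_mem {m₁ m₂ : MbDiagram n} (hm₁ : IsMb0 m₁ ∨ IsMb1 m₁)
    (hm₂ : IsMb0 m₂ ∨ IsMb1 m₂) (v : Fin (2 * n)) (ε₁ ε₂ : Bool) :
    let e₁ := if ε₁ then ∑ i ∈ Finset.range ((m₁.oppPair m₂).period v),
      crossShift (m₁.shift (((m₁.oppPair m₂).turn ^ i) v)) else 0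
    let e₂ := if ε₂ then ∑ i ∈ Finset.range ((m₁.oppPair m₂).period v),
      crossShift (m₂.shift (m₁.opp (((m₁.oppPair m₂).turn ^ i) v))) else 0
    closedWinding m₁ m₂ v + e₁ + e₂ = 0 ∨ closedWinding m₁ m₂ v + e₁ + e₂ = 1 ∨
      closedWinding m₁ m₂ v + e₁ + e₂ = -1 := by
  intro e₁ e₂
  have h := winding_mem (closeUp m₁ hm₁ ε₁) (closeUp m₂ hm₂ ε₂) v
  have hD : (closeUp m₁ hm₁ ε₁).oppPair (closeUp m₂ hm₂ ε₂) = m₁.oppPair m₂ := rfl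
  rw [hD] at h
  have e : (m₁.oppPair m₂).winding (closeUp m₁ hm₁ ε₁).shift (closeUp m₂ hm₂ ε₂).shift v =
      closedWinding m₁ m₂ v + e₁ + e₂ := by
    have c1 : ∀ (ε : Bool) (s : ℤ), closeShift ε s =
        closeShift false s + if ε then crossShift s else 0 := by
      intro ε s
      cases ε
      · simp
      · simp [closeShift_true]
    simp only [MatchingPair.winding, MatchingPair.windingSum, closedWinding, closeUp_shift]
    rw [add_assoc]
    have c2 : e₁ + e₂ = ∑ i ∈ Finset.range ((m₁.oppPair m₂).period v),
        ((if ε₁ then crossShift (m₁.shift (((m₁.oppPair m₂).turn ^ i) v)) else 0) +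
        if ε₂ then crossShift (m₂.shift (m₁.opp (((m₁.oppPair m₂).turn ^ i) v))) else 0) := by
      rw [Finset.sum_add_distrib]
      cases ε₁ <;> cases ε₂ <;> simp [e₁, e₂]
    rw [c2, ← Finset.sum_add_distrib]
    refine Finset.sum_congr rfl fun i _ => ?_
    rw [c1 ε₁, c1 ε₂]
    change _ + (_ + if ε₂ then crossShift (m₂.shift (m₁.opp _)) else 0) = _
    ring
  rw [← e]
  exact h

theorem isCurveOfClass_of_turn {m₁ m₂ : MbDiagram n} {v : Fin (2 * n)} {H : KleinGroup}
    (hH : ((kleinPair m₁ m₂).turn ^ (m₁.oppPair m₂).period v) (1, v) = (H, v)) {g : KleinGroup}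
    (hg : H = g ∨ H = g⁻¹) :
    IsCurveOfClass m₁ m₂ ((mbGlue m₁ m₂).connectedComponentMk v) g := by
  refine ⟨v, rfl, 1, ?_⟩
  rw [kleinPair_stabilizer v H hH, one_mul, inv_one, mul_one]
  rcases hg with rfl | rfl
  · rfl
  · rw [Subgroup.zpowers_inv]

theorem turn_kleinPair_period {m₁ m₂ : MbDiagram n} (v : Fin (2 * n))
    (h : ∀ i, 0 < i → i < (m₁.oppPair m₂).period v →
      ((m₁.oppPair m₂).turn ^ i) v ∉ crossing m₁) :
    ((kleinPair m₁ m₂).turn ^ (m₁.oppPair m₂).period v) (1, v) =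
      ((coreA ^ 2) ^ closedWinding m₁ m₂ v * (coreA ^ crossShift (m₁.shift v) *
          coreB ^ ∑ i ∈ Finset.range ((m₁.oppPair m₂).period v),
            crossShift (m₂.shift (m₁.opp (((m₁.oppPair m₂).turn ^ i) v)))), v) := by
  have hP := (m₁.oppPair m₂).period_pos v
  obtain ⟨k, hk⟩ : ∃ k, (m₁.oppPair m₂).period v = k + 1 := ⟨_, (Nat.sub_add_cancel hP).symm⟩
  have e := (m₁.oppPair m₂).turn_pow_period v
  rw [closedWinding, MatchingPair.winding]
  rw [hk] at h e ⊢
  rw [turn_kleinPair_pow v k h, e]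

section Labels

variable {m₁ m₂ : MbDiagram n} {v : Fin (2 * n)}

theorem sum_crossShift_left (h : ∀ i, 0 < i → i < (m₁.oppPair m₂).period v →
    ((m₁.oppPair m₂).turn ^ i) v ∉ crossing m₁) :
    ∑ i ∈ Finset.range ((m₁.oppPair m₂).period v),
      crossShift (m₁.shift (((m₁.oppPair m₂).turn ^ i) v)) = crossShift (m₁.shift v) := by
  rw [Finset.sum_eq_single 0]
  · rfl
  · intro i hi hi0
    exact crossShift_eq_zero (h i (Nat.pos_of_ne_zero hi0) (Finset.mem_range.1 hi))
  · intro h0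
    exact absurd (Finset.mem_range.2 ((m₁.oppPair m₂).period_pos v)) h0

theorem sum_crossShift_right_eq_zero (h : ∀ u, (m₁.oppPair m₂).Orbit v u → u ∉ crossing m₂) :
    ∑ i ∈ Finset.range ((m₁.oppPair m₂).period v),
      crossShift (m₂.shift (m₁.opp (((m₁.oppPair m₂).turn ^ i) v))) = 0 :=
  Finset.sum_eq_zero fun i _ => crossShift_eq_zero
    (h _ ((MatchingPair.orbit_turn_pow v i).trans (MatchingPair.orbit_f (D := m₁.oppPair m₂) _)))

/-- A closed curve runs at most once through the arc that intersects the second crosscap. -/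
theorem sum_crossShift_right (hm₂ : IsMb0 m₂ ∨ IsMb1 m₂) {b : Fin (2 * n)}
    (hb : b ∈ crossing m₂) (h : (m₁.oppPair m₂).Orbit v b) :
    ∑ i ∈ Finset.range ((m₁.oppPair m₂).period v),
      crossShift (m₂.shift (m₁.opp (((m₁.oppPair m₂).turn ^ i) v))) = 1 ∨
    ∑ i ∈ Finset.range ((m₁.oppPair m₂).period v),
      crossShift (m₂.shift (m₁.opp (((m₁.oppPair m₂).turn ^ i) v))) = -1 := by
  obtain ⟨r, hr, hrB, huniq⟩ := MatchingPair.exists_unique_crossing (D := m₁.oppPair m₂)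
    (isArcEnds_crossing hm₂) hb h
  change m₁.opp _ ∈ _ at hrB
  rw [Finset.sum_eq_single r, crossShift_eq hrB]
  · rcases shift_of_mem_crossing m₂ hrB with ⟨h, -⟩ | ⟨h, -⟩ <;> simp [h]
  · intro i hi hir
    exact crossShift_eq_zero fun hmem => hir (huniq i (Finset.mem_range.1 hi) hmem)
  · intro h0
    exact absurd (Finset.mem_range.2 hr) h0

theorem not_mem_crossing_of_lt (hm₁ : IsMb0 m₁ ∨ IsMb1 m₁) (hv : v ∈ crossing m₁) (i : ℕ)
    (hi0 : 0 < i) (hi : i < (m₁.oppPair m₂).period v) :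
    ((m₁.oppPair m₂).turn ^ i) v ∉ crossing m₁ := by
  intro hmem
  rcases (isArcEnds_crossing hm₁).2 v hv _ hmem with h | h
  · have := MatchingPair.turn_pow_injOn hi (MatchingPair.period_pos v) (by simpa using h)
    omega
  · exact MatchingPair.f_turn_pow_ne_turn_pow (D := m₁.oppPair m₂) 0 i v h.symm

/-- A closed curve that is disjoint from both crosscaps lies in an annulus. -/
theorem label_of_disjoint (hm₁ : IsMb0 m₁ ∨ IsMb1 m₁) (hm₂ : IsMb0 m₂ ∨ IsMb1 m₂)
    (h₁ : ∀ u, (m₁.oppPair m₂).Orbit v u → u ∉ crossing m₁)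
    (h₂ : ∀ u, (m₁.oppPair m₂).Orbit v u → u ∉ crossing m₂) :
    (closedWinding m₁ m₂ v = 0 → IsCurveOfClass m₁ m₂
      ((mbGlue m₁ m₂).connectedComponentMk v) (curveLoop .d)) ∧
    (closedWinding m₁ m₂ v ≠ 0 → IsCurveOfClass m₁ m₂
      ((mbGlue m₁ m₂).connectedComponentMk v) (curveLoop .z)) := by
  have h := turn_kleinPair_period (m₁ := m₁) (m₂ := m₂) v fun i _ _ =>
    h₁ _ (MatchingPair.orbit_turn_pow v i)
  rw [sum_crossShift_right_eq_zero h₂, crossShift_eq_zero (h₁ v (MatchingPair.Orbit.refl v)),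
    zpow_zero, zpow_zero, mul_one, mul_one] at h
  have hW := closedWinding_mem hm₁ hm₂ v false false
  simp only [Bool.false_eq_true, if_false, add_zero] at hW
  constructor
  · intro h0
    exact isCurveOfClass_of_turn h (Or.inl (by rw [h0, zpow_zero]; rfl))
  · intro h0
    refine isCurveOfClass_of_turn h ?_
    rcases hW with hW | hW | hW
    · exact absurd hW h0
    · exact Or.inl (by rw [hW, zpow_one]; rfl)
    · exact Or.inr (by rw [hW, zpow_neg_one]; rfl)

theorem label_of_left (hm₁ : IsMb0 m₁ ∨ IsMb1 m₁) (hm₂ : IsMb0 m₂ ∨ IsMb1 m₂)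
    (hv : v ∈ crossing m₁) (h₂ : ∀ u, (m₁.oppPair m₂).Orbit v u → u ∉ crossing m₂) :
    IsCurveOfClass m₁ m₂ ((mbGlue m₁ m₂).connectedComponentMk v) (curveLoop .x) := by
  have hc := not_mem_crossing_of_lt (m₂ := m₂) hm₁ hv
  have h := turn_kleinPair_period v hc
  have hW₀ := closedWinding_mem hm₁ hm₂ v false false
  have hW₁ := closedWinding_mem hm₁ hm₂ v true false
  simp only [Bool.false_eq_true, if_false, if_true, add_zero, sum_crossShift_left hc,
    crossShift_eq hv] at hW₀ hW₁
  rw [sum_crossShift_right_eq_zero h₂, zpow_zero, mul_one, crossShift_eq hv, ← zpow_natCast coreA 2,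
    ← zpow_mul, ← zpow_add] at h
  refine isCurveOfClass_of_turn h ?_
  have : ((2 : ℕ) : ℤ) * closedWinding m₁ m₂ v + m₁.shift v = 1 ∨
      ((2 : ℕ) : ℤ) * closedWinding m₁ m₂ v + m₁.shift v = -1 := by
    have := shift_of_mem_crossing m₁ hv
    push_cast
    omega
  rcases this with e | e
  · exact Or.inl (by rw [e, zpow_one]; rfl)
  · exact Or.inr (by rw [e, zpow_neg_one]; rfl)

theorem label_of_right (hm₁ : IsMb0 m₁ ∨ IsMb1 m₁) (hm₂ : IsMb0 m₂ ∨ IsMb1 m₂) {b : Fin (2 * n)}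
    (hb : b ∈ crossing m₂) (hvb : (m₁.oppPair m₂).Orbit v b)
    (h₁ : ∀ u, (m₁.oppPair m₂).Orbit v u → u ∉ crossing m₁) :
    IsCurveOfClass m₁ m₂ ((mbGlue m₁ m₂).connectedComponentMk v) (curveLoop .y) := by
  have h := turn_kleinPair_period (m₁ := m₁) (m₂ := m₂) v fun i _ _ =>
    h₁ _ (MatchingPair.orbit_turn_pow v i)
  have hE := sum_crossShift_right hm₂ hb hvb
  have hW₀ := closedWinding_mem hm₁ hm₂ v false false
  have hW₁ := closedWinding_mem hm₁ hm₂ v false true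
  simp only [Bool.false_eq_true, if_false, if_true, add_zero] at hW₀ hW₁
  rw [crossShift_eq_zero (h₁ v (MatchingPair.Orbit.refl v)), zpow_zero, one_mul, coreA_sq,
    ← zpow_natCast coreB 2, ← zpow_mul, ← zpow_add] at h
  refine isCurveOfClass_of_turn h ?_
  generalize ∑ i ∈ Finset.range ((m₁.oppPair m₂).period v),
    crossShift (m₂.shift (m₁.opp (((m₁.oppPair m₂).turn ^ i) v))) = E at *
  have : ((2 : ℕ) : ℤ) * closedWinding m₁ m₂ v + E = 1 ∨
      ((2 : ℕ) : ℤ) * closedWinding m₁ m₂ v + E = -1 := by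
    push_cast
    omega
  rcases this with e | e
  · exact Or.inl (by rw [e, zpow_one]; rfl)
  · exact Or.inr (by rw [e, zpow_neg_one]; rfl)

theorem label_of_both (hm₁ : IsMb0 m₁ ∨ IsMb1 m₁) (hm₂ : IsMb0 m₂ ∨ IsMb1 m₂) {b : Fin (2 * n)}
    (hv : v ∈ crossing m₁) (hb : b ∈ crossing m₂) (hvb : (m₁.oppPair m₂).Orbit v b) :
    IsCurveOfClass m₁ m₂ ((mbGlue m₁ m₂).connectedComponentMk v) (curveLoop .w) := by
  -- the curve is traversed in the direction in which it runs along the core `a` positively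
  wlog hs : m₁.shift v = 1 generalizing v
  · have hf : (m₁.oppPair m₂).Orbit v (m₁.opp v) := MatchingPair.orbit_f v
    have hs' : m₁.shift (m₁.opp v) = 1 := by
      rw [m₁.shift_opp]
      have := shift_of_mem_crossing m₁ hv
      omega
    have h := this (opp_mem_crossing hv) (hf.symm.trans hvb) hs'
    rwa [SimpleGraph.ConnectedComponent.sound ((mbGlue_reachable_iff m₁ m₂).2 hf.symm)] at h
  have hs₁ : crossShift (m₁.shift v) = 1 := by rw [crossShift_eq hv, hs]
  have hc := not_mem_crossing_of_lt (m₂ := m₂) hm₁ hv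
  have h := turn_kleinPair_period v hc
  have hE := sum_crossShift_right hm₂ hb hvb
  have hW₀ := closedWinding_mem hm₁ hm₂ v false false
  have hW₁ := closedWinding_mem hm₁ hm₂ v true false
  have hW₂ := closedWinding_mem hm₁ hm₂ v false true
  have hW₃ := closedWinding_mem hm₁ hm₂ v true true
  simp only [Bool.false_eq_true, if_false, if_true, add_zero, sum_crossShift_left hc,
    hs₁] at hW₀ hW₁ hW₂ hW₃
  rw [hs₁, zpow_one] at h
  refine isCurveOfClass_of_turn h (Or.inl ?_)
  generalize ∑ i ∈ Finset.range ((m₁.oppPair m₂).period v),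
    crossShift (m₂.shift (m₁.opp (((m₁.oppPair m₂).turn ^ i) v))) = E at *
  rcases hE with rfl | rfl
  · rw [show closedWinding m₁ m₂ v = -1 by omega, zpow_neg_one, ← mul_assoc]
    have e := (commute_coreA (-1) 1).eq
    rw [zpow_neg_one, zpow_one] at e
    rw [e, coreA_sq, curveLoop, zpow_one, mul_assoc]
    congr 1
    group
  · rw [show closedWinding m₁ m₂ v = 0 by omega, zpow_zero, one_mul, zpow_neg_one]
    rfl

end Labels

/-! ### Pieces of curves in the glued annulus -/

variable {n p q : ℕ}

/-- The diagram `b` in the annulus is obtained from `m` by replacing the crosscap by an inner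
boundary, and its inner marked point `j` is joined to the outer marked point `e j` by an arc that is
disjoint from the lollipop. -/
structure IsCut (m : MbDiagram n) (b : AnnDiagram n p) (e : Fin p → Fin (2 * n)) : Prop where
  opp_inl : ∀ l ∉ crossing m, b.opp (Sum.inl l) = Sum.inl (m.opp l)
  shift_inl : ∀ l ∉ crossing m, 2 * b.shift (Sum.inl l) = m.shift l
  opp_inr : ∀ j, b.opp (Sum.inr j) = Sum.inl (e j)
  shift_inr : ∀ j, b.shift (Sum.inr j) = 0
  mem_crossing : ∀ j, e j ∈ crossing m
  exists_eq : ∀ l ∈ crossing m, ∃ j, e j = l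

theorem IsCut.opp_end {m : MbDiagram n} {b : AnnDiagram n p} {e : Fin p → Fin (2 * n)}
    (h : IsCut m b e) (j : Fin p) : b.opp (Sum.inl (e j)) = Sum.inr j := by
  rw [← h.opp_inr, b.opp_opp]

theorem exists_isCut {m : MbDiagram n} {b : AnnDiagram n p} (h : SameOuterArcs m b)
    (hb : ∀ j : Fin p, ∃ l : Fin (2 * n), b.mate (0, Sum.inr j) = (0, Sum.inl l)) :
    ∃ e, IsCut m b e := by
  choose e he using hb
  have hcross : ∀ l l' (k : ℤ), b.mate (0, Sum.inl l) = (k, Sum.inl l') →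
      m.opp l = l' ∧ m.shift l = 2 * k := by
    intro l l' k hk
    rw [h, mul_zero] at hk
    exact ⟨congrArg Prod.snd hk, congrArg Prod.fst hk⟩
  have hmate : ∀ l ∉ crossing m,
      b.mate (0, Sum.inl l) = (m.shift l / 2, Sum.inl (m.opp l)) := by
    intro l hl
    rw [h, m.mate_mk]
    rcases shift_mod_two m l with ⟨hl', -⟩ | ⟨-, hs⟩
    · exact absurd hl' hl
    · ext1 <;> simp only; omega
  refine ⟨e, fun l hl => congrArg Prod.snd (hmate l hl), fun l hl => ?_,
    fun j => congrArg Prod.snd (he j), fun j => congrArg Prod.fst (he j), fun j => ?_,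
    fun l hl => ?_⟩
  · rw [Connection.shift, hmate l hl]
    rcases shift_mod_two m l with ⟨hl', -⟩ | ⟨-, hs⟩
    · exact absurd hl' hl
    · simp only; omega
  · by_contra hmem
    have h1 := b.mate_symm (he j) 0
    rw [hmate _ hmem] at h1
    exact Sum.inl_ne_inr (congrArg Prod.snd h1)
  · rcases hl' : b.mate (0, Sum.inl l) with ⟨k, l' | j⟩
    · have h1 := (hcross l l' k hl').2
      rw [crossing, Set.mem_ofPred_eq, h1, Int.odd_iff] at hl
      omega
    · have h1 := b.mate_symm hl' 0
      rw [he] at h1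
      exact ⟨j, Sum.inl_injective (congrArg Prod.snd h1)⟩

/-- Contracts the arcs that end on the inner or on the outer boundary of the glued annulus. -/
def retract (e₁ : Fin p → Fin (2 * n)) (e₂ : Fin q → Fin (2 * n)) : AnnVertex n p q → Fin (2 * n) :=
  Sum.elim id (Sum.elim e₁ e₂)

section Glue

variable {m₁ m₂ : MbDiagram n} {b₁ : AnnDiagram n p} {b₂ : AnnDiagram n q}
  {e₁ : Fin p → Fin (2 * n)} {e₂ : Fin q → Fin (2 * n)}

theorem annGlue_reachable_left (s : Fin (2 * n) ⊕ Fin p) :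
    (annGlue b₁ b₂).Reachable (annLeft s) (annLeft (b₁.opp s)) :=
  fromRel_reachable_iff.2 (Relation.EqvGen.rel _ _ (Or.inl ⟨s, rfl, rfl⟩))

theorem annGlue_reachable_right (s : Fin (2 * n) ⊕ Fin q) :
    (annGlue b₁ b₂).Reachable (annRight s) (annRight (b₂.opp s)) :=
  fromRel_reachable_iff.2 (Relation.EqvGen.rel _ _ (Or.inr ⟨s, rfl, rfl⟩))

theorem annGlue_reachable_retract (h₁ : IsCut m₁ b₁ e₁) (h₂ : IsCut m₂ b₂ e₂)
    (s : AnnVertex n p q) : (annGlue b₁ b₂).Reachable s (Sum.inl (retract e₁ e₂ s)) := by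
  rcases s with l | j | j
  · exact SimpleGraph.Reachable.refl _
  · have h := annGlue_reachable_left (b₁ := b₁) (b₂ := b₂) (Sum.inr j)
    rw [h₁.opp_inr] at h
    exact h
  · have h := annGlue_reachable_right (b₁ := b₁) (b₂ := b₂) (Sum.inr j)
    rw [h₂.opp_inr] at h
    exact h

/-- The curves and arcs in the glued annulus are the pieces into which the curves in the Klein bottle
fall when the arcs that intersect the crosscaps are removed. -/
theorem annGlue_reachable_iff (h₁ : IsCut m₁ b₁ e₁) (h₂ : IsCut m₂ b₂ e₂)
    {s t : AnnVertex n p q} : (annGlue b₁ b₂).Reachable s t ↔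
      (m₁.oppPair m₂).Linked (crossing m₁) (crossing m₂) (retract e₁ e₂ s)
        (retract e₁ e₂ t) := by
  constructor
  · intro h
    refine (MatchingPair.eqvGen_iff (p := fun t => (m₁.oppPair m₂).Linked (crossing m₁)
      (crossing m₂) (retract e₁ e₂ s) (retract e₁ e₂ t)) ?_ (fromRel_reachable_iff.1 h)).1
      (MatchingPair.Linked.refl _)
    have key : ∀ {x y : Fin (2 * n)}, (m₁.oppPair m₂).Linked (crossing m₁) (crossing m₂) x y →
        ((m₁.oppPair m₂).Linked (crossing m₁) (crossing m₂) (retract e₁ e₂ s) x ↔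
          (m₁.oppPair m₂).Linked (crossing m₁) (crossing m₂) (retract e₁ e₂ s) y) :=
      fun h => ⟨(·.trans h), (·.trans h.symm)⟩
    rintro u v (⟨s, rfl, rfl⟩ | ⟨s, rfl, rfl⟩)
    · change _ ↔ (m₁.oppPair m₂).Linked _ _ _ (retract e₁ e₂ (annLeft (b₁.opp s)))
      apply key
      rcases s with l | j
      · by_cases hl : l ∈ crossing m₁
        · obtain ⟨j, rfl⟩ := h₁.exists_eq l hl
          rw [h₁.opp_end]
          exact MatchingPair.Linked.refl _
        · rw [h₁.opp_inl l hl]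
          exact MatchingPair.linked_f (D := m₁.oppPair m₂) hl
      · rw [h₁.opp_inr]
        exact MatchingPair.Linked.refl _
    · change _ ↔ (m₁.oppPair m₂).Linked _ _ _ (retract e₁ e₂ (annRight (b₂.opp s)))
      apply key
      rcases s with l | j
      · by_cases hl : l ∈ crossing m₂
        · obtain ⟨j, rfl⟩ := h₂.exists_eq l hl
          rw [h₂.opp_end]
          exact MatchingPair.Linked.refl _
        · rw [h₂.opp_inl l hl]
          exact MatchingPair.linked_g (D := m₁.oppPair m₂) hl
      · rw [h₂.opp_inr]
        exact MatchingPair.Linked.refl _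
  · intro h
    refine (annGlue_reachable_retract h₁ h₂ s).trans
      (SimpleGraph.Reachable.trans ?_ (annGlue_reachable_retract h₁ h₂ t).symm)
    refine (MatchingPair.eqvGen_iff (p := fun v : Fin (2 * n) => (annGlue b₁ b₂).Reachable
      (Sum.inl (retract e₁ e₂ s)) (Sum.inl v)) ?_ h).1 (SimpleGraph.Reachable.refl _)
    have key : ∀ {x y : AnnVertex n p q}, (annGlue b₁ b₂).Reachable x y →
        ((annGlue b₁ b₂).Reachable (Sum.inl (retract e₁ e₂ s)) x ↔
          (annGlue b₁ b₂).Reachable (Sum.inl (retract e₁ e₂ s)) y) :=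
      fun h => ⟨(·.trans h), (·.trans h.symm)⟩
    rintro x y (⟨hx, rfl⟩ | ⟨hx, rfl⟩)
    · have h := annGlue_reachable_left (b₁ := b₁) (b₂ := b₂) (Sum.inl x)
      rw [h₁.opp_inl x hx] at h
      exact key h
    · have h := annGlue_reachable_right (b₁ := b₁) (b₂ := b₂) (Sum.inl x)
      rw [h₂.opp_inl x hx] at h
      exact key h

theorem meetsInner_mk_iff (hm₁ : IsMb0 m₁ ∨ IsMb1 m₁) (hm₂ : IsMb0 m₂ ∨ IsMb1 m₂)
    (h₁ : IsCut m₁ b₁ e₁) (h₂ : IsCut m₂ b₂ e₂) {s : AnnVertex n p q} :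
    MeetsInner b₁ b₂ ((annGlue b₁ b₂).connectedComponentMk s) ↔
      ∃ u ∈ crossing m₁, (m₁.oppPair m₂).Orbit (retract e₁ e₂ s) u := by
  rw [← MatchingPair.exists_linked_left_iff (isArcEnds_crossing hm₁) (isArcEnds_crossing hm₂)]
  simp only [MeetsInner, SimpleGraph.ConnectedComponent.mem_supp_iff,
    SimpleGraph.ConnectedComponent.eq, annGlue_reachable_iff h₁ h₂]
  constructor
  · rintro ⟨j, hj⟩
    exact ⟨e₁ j, h₁.mem_crossing j, hj.symm⟩
  · rintro ⟨u, hu, hl⟩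
    obtain ⟨j, rfl⟩ := h₁.exists_eq u hu
    exact ⟨j, hl.symm⟩

theorem meetsOuter_mk_iff (hm₁ : IsMb0 m₁ ∨ IsMb1 m₁) (hm₂ : IsMb0 m₂ ∨ IsMb1 m₂)
    (h₁ : IsCut m₁ b₁ e₁) (h₂ : IsCut m₂ b₂ e₂) {s : AnnVertex n p q} :
    MeetsOuter b₁ b₂ ((annGlue b₁ b₂).connectedComponentMk s) ↔
      ∃ u ∈ crossing m₂, (m₁.oppPair m₂).Orbit (retract e₁ e₂ s) u := by
  rw [← MatchingPair.exists_linked_right_iff (isArcEnds_crossing hm₁) (isArcEnds_crossing hm₂)]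
  simp only [MeetsOuter, SimpleGraph.ConnectedComponent.mem_supp_iff,
    SimpleGraph.ConnectedComponent.eq, annGlue_reachable_iff h₁ h₂]
  constructor
  · rintro ⟨j, hj⟩
    exact ⟨e₂ j, h₂.mem_crossing j, hj.symm⟩
  · rintro ⟨u, hu, hl⟩
    obtain ⟨j, rfl⟩ := h₂.exists_eq u hu
    exact ⟨j, hl.symm⟩

/-- The lifts of a closed curve to the universal cover of the glued annulus are the lifts of the
curve that is formed by the closed up diagrams. -/
theorem annGlueCover_reachable_iff (hm₁ : IsMb0 m₁ ∨ IsMb1 m₁) (hm₂ : IsMb0 m₂ ∨ IsMb1 m₂)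
    (h₁ : IsCut m₁ b₁ e₁) (h₂ : IsCut m₂ b₂ e₂) {v : Fin (2 * n)}
    (hv₁ : ∀ u ∈ crossing m₁, ¬ (m₁.oppPair m₂).Orbit v u)
    (hv₂ : ∀ u ∈ crossing m₂, ¬ (m₁.oppPair m₂).Orbit v u) (k : ℤ) :
    (annGlueCover b₁ b₂).Reachable (0, Sum.inl v) (k, Sum.inl v) ↔
      ∃ j : ℤ, k = j * closedWinding m₁ m₂ v := by
  set c₁ := closeUp m₁ hm₁ false with hc₁
  set c₂ := closeUp m₂ hm₂ false with hc₂
  have hw := c₁.orbit_cover_iff c₂ k v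
  have hwind : (c₁.oppPair c₂).winding c₁.shift c₂.shift v = closedWinding m₁ m₂ v := by
    simp only [closedWinding, hc₁, hc₂, funext (closeUp_shift hm₁ false),
      funext (closeUp_shift hm₂ false)]
    rfl
  rw [hwind] at hw
  rw [← hw]
  have hproj : ∀ {k u}, (c₁.coverPair c₂).Orbit (0, v) (k, u) → (m₁.oppPair m₂).Orbit v u :=
    fun h => h.map (E := m₁.oppPair m₂) (π := Prod.snd)
      (fun x => by change (c₁.mate (x.1, x.2)).2 = _; rw [c₁.mate_mk]; rfl)
      (fun x => by change (c₂.mate (x.1, x.2)).2 = _; rw [c₂.mate_mk]; rfl)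
  have hshift : ∀ {p' : ℕ} {m : MbDiagram n} {b : AnnDiagram n p'} {e : Fin p' → Fin (2 * n)}
      (hm : IsMb0 m ∨ IsMb1 m), IsCut m b e → ∀ l ∉ crossing m, ∀ k : ℤ,
      b.mate (k, Sum.inl l) = (((closeUp m hm false).mate (k, l)).1,
        Sum.inl ((closeUp m hm false).mate (k, l)).2) := by
    intro p' m b e hm h l hl k
    rw [b.mate_mk, Connection.mate_mk, closeUp_shift, closeUp_opp, h.opp_inl l hl]
    have e1 := h.shift_inl l hl
    have e2 := closeShift_even (s := m.shift l) false (by omega)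
    ext1
    · simp only; omega
    · rfl
  constructor
  · intro h
    let P : ℤ × AnnVertex n p q → Prop
      | (k, Sum.inl u) => (c₁.coverPair c₂).Orbit (0, v) (k, u)
      | (_, Sum.inr _) => False
    refine (MatchingPair.eqvGen_iff (p := P) ?_ (fromRel_reachable_iff.1 h)).1
      (MatchingPair.Orbit.refl (D := c₁.coverPair c₂) (0, v))
    rintro ⟨k, u⟩ y (⟨s, hs, rfl⟩ | ⟨s, hs, rfl⟩)
    · simp only at hs
      subst hs
      rcases s with l | j
      · by_cases hl : l ∈ crossing m₁
        · obtain ⟨j, rfl⟩ := h₁.exists_eq l hl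
          simp only [b₁.mate_mk, h₁.opp_end]
          exact ⟨fun h => hv₁ _ hl (hproj h), False.elim⟩
        · simp only [hshift hm₁ h₁ l hl]
          have hf := MatchingPair.orbit_f (D := c₁.coverPair c₂) (k, l)
          exact ⟨fun h => MatchingPair.Orbit.trans h hf,
            fun h => MatchingPair.Orbit.trans (D := c₁.coverPair c₂) h hf.symm⟩
      · simp only [b₁.mate_mk, h₁.opp_inr]
        exact ⟨False.elim, fun h => hv₁ _ (h₁.mem_crossing j) (hproj h)⟩
    · simp only at hs
      subst hs
      rcases s with l | j
      · by_cases hl : l ∈ crossing m₂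
        · obtain ⟨j, rfl⟩ := h₂.exists_eq l hl
          simp only [b₂.mate_mk, h₂.opp_end]
          exact ⟨fun h => hv₂ _ hl (hproj h), False.elim⟩
        · simp only [hshift hm₂ h₂ l hl]
          have hf := MatchingPair.orbit_g (D := c₁.coverPair c₂) (k, l)
          exact ⟨fun h => MatchingPair.Orbit.trans h hf,
            fun h => MatchingPair.Orbit.trans (D := c₁.coverPair c₂) h hf.symm⟩
      · simp only [b₂.mate_mk, h₂.opp_inr]
        exact ⟨False.elim, fun h => hv₂ _ (h₂.mem_crossing j) (hproj h)⟩
  · intro h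
    let P : ℤ × Fin (2 * n) → Prop := fun y => (c₁.coverPair c₂).Orbit (0, v) y ∧
      (annGlueCover b₁ b₂).Reachable (0, Sum.inl v) (y.1, Sum.inl y.2)
    have hf : ∀ y, P y → P ((c₁.coverPair c₂).f y) := by
      rintro ⟨k, l⟩ ⟨ho, hr⟩
      refine ⟨ho.trans (MatchingPair.orbit_f _), hr.trans (fromRel_reachable_iff.2
        (Relation.EqvGen.rel _ _ (Or.inl ⟨Sum.inl l, rfl, ?_⟩)))⟩
      simp only [hshift hm₁ h₁ l fun hl => hv₁ _ hl (hproj ho)]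
      rfl
    have hg : ∀ y, P y → P ((c₁.coverPair c₂).g y) := by
      rintro ⟨k, l⟩ ⟨ho, hr⟩
      refine ⟨ho.trans (MatchingPair.orbit_g _), hr.trans (fromRel_reachable_iff.2
        (Relation.EqvGen.rel _ _ (Or.inr ⟨Sum.inl l, rfl, ?_⟩)))⟩
      simp only [hshift hm₂ h₂ l fun hl => hv₂ _ hl (hproj ho)]
      rfl
    refine ((MatchingPair.eqvGen_iff (p := P) ?_ h).1
      ⟨MatchingPair.Orbit.refl _, SimpleGraph.Reachable.refl _⟩).2
    rintro x y (rfl | rfl)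
    · exact ⟨hf x, fun h => by simpa only [MatchingPair.f_f] using hf _ h⟩
    · exact ⟨hg x, fun h => by simpa only [MatchingPair.g_g] using hg _ h⟩

end Glue

/-! ### Comparison of the two bilinear forms -/

section Count

variable {n p q : ℕ} {m₁ m₂ : MbDiagram n} {b₁ : AnnDiagram n p} {b₂ : AnnDiagram n q}
  {e₁ : Fin p → Fin (2 * n)} {e₂ : Fin q → Fin (2 * n)}

/-- The label of a closed curve in the Klein bottle is determined by the crosscaps that it meets and,
if it meets none, by its winding number. -/
theorem exists_label (hm₁ : IsMb0 m₁ ∨ IsMb1 m₁) (hm₂ : IsMb0 m₂ ∨ IsMb1 m₂) (v : Fin (2 * n)) :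
    ∃ t, IsCurveOfClass m₁ m₂ ((mbGlue m₁ m₂).connectedComponentMk v) (curveLoop t) ∧
      ((∃ u ∈ crossing m₁, (m₁.oppPair m₂).Orbit v u) ↔ t = .x ∨ t = .w) ∧
      ((∃ u ∈ crossing m₂, (m₁.oppPair m₂).Orbit v u) ↔ t = .y ∨ t = .w) ∧
      ((t = .d ∨ t = .z) → (t = .d ↔ closedWinding m₁ m₂ v = 0)) := by
  by_cases h₁ : ∃ u ∈ crossing m₁, (m₁.oppPair m₂).Orbit v u <;>
    by_cases h₂ : ∃ u ∈ crossing m₂, (m₁.oppPair m₂).Orbit v u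
  · obtain ⟨u, hu, hvu⟩ := h₁
    obtain ⟨b, hb, hvb⟩ := h₂
    refine ⟨.w, ?_, by simpa using ⟨u, hu, hvu⟩, by simpa using ⟨b, hb, hvb⟩, by simp⟩
    rw [SimpleGraph.ConnectedComponent.sound ((mbGlue_reachable_iff m₁ m₂).2 hvu)]
    exact label_of_both hm₁ hm₂ hu hb (hvu.symm.trans hvb)
  · obtain ⟨u, hu, hvu⟩ := h₁
    refine ⟨.x, ?_, by simpa using ⟨u, hu, hvu⟩, by simpa using h₂, by simp⟩
    rw [SimpleGraph.ConnectedComponent.sound ((mbGlue_reachable_iff m₁ m₂).2 hvu)]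
    exact label_of_left hm₁ hm₂ hu fun w hw hwm => h₂ ⟨w, hwm, hvu.trans hw⟩
  · have h₁' : ∀ u, (m₁.oppPair m₂).Orbit v u → u ∉ crossing m₁ :=
      fun u hu hmem => h₁ ⟨u, hmem, hu⟩
    obtain ⟨b, hb, hvb⟩ := h₂
    exact ⟨.y, label_of_right hm₁ hm₂ hb hvb h₁', by simpa using h₁, by simpa using ⟨b, hb, hvb⟩,
      by simp⟩
  · have h := label_of_disjoint (v := v) hm₁ hm₂ (fun u hu hmem => h₁ ⟨u, hmem, hu⟩)
      (fun u hu hmem => h₂ ⟨u, hmem, hu⟩)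
    by_cases hW : closedWinding m₁ m₂ v = 0
    · exact ⟨.d, h.1 hW, by simpa using h₁, by simpa using h₂, by simp [hW]⟩
    · exact ⟨.z, h.2 hW, by simpa using h₁, by simpa using h₂, by simp [hW]⟩

/-- The curve in the Klein bottle that contains a given curve or arc in the glued annulus. -/
def project (h₁ : IsCut m₁ b₁ e₁) (h₂ : IsCut m₂ b₂ e₂) :
    (annGlue b₁ b₂).ConnectedComponent → (mbGlue m₁ m₂).ConnectedComponent :=
  Quot.map (retract e₁ e₂) fun _ _ h =>
    (mbGlue_reachable_iff m₁ m₂).2 ((annGlue_reachable_iff h₁ h₂).1 h).orbit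

theorem project_mk (h₁ : IsCut m₁ b₁ e₁) (h₂ : IsCut m₂ b₂ e₂) (s : AnnVertex n p q) :
    project h₁ h₂ ((annGlue b₁ b₂).connectedComponentMk s) =
      (mbGlue m₁ m₂).connectedComponentMk (retract e₁ e₂ s) := rfl

/-- The property of a curve or arc in the glued annulus that determines its label. -/
def HasLabel (b₁ : AnnDiagram n p) (b₂ : AnnDiagram n q) (C : (annGlue b₁ b₂).ConnectedComponent) :
    CurveVar → Prop
  | .d => IsClosedCurve b₁ b₂ C ∧ IsNullHomotopic b₁ b₂ C
  | .x => MeetsInner b₁ b₂ C ∧ ¬ MeetsOuter b₁ b₂ C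
  | .y => ¬ MeetsInner b₁ b₂ C ∧ MeetsOuter b₁ b₂ C
  | .z => IsClosedCurve b₁ b₂ C ∧ ¬ IsNullHomotopic b₁ b₂ C
  | .w => MeetsInner b₁ b₂ C ∧ MeetsOuter b₁ b₂ C

/-- For curves that are disjoint from the crosscaps, both sides mean that the winding number is `0`. -/
theorem isNullHomotopic_iff (hm₁ : IsMb0 m₁ ∨ IsMb1 m₁) (hm₂ : IsMb0 m₂ ∨ IsMb1 m₂)
    (h₁ : IsCut m₁ b₁ e₁) (h₂ : IsCut m₂ b₂ e₂)
    {s : AnnVertex n p q}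
    (hI : ¬ MeetsInner b₁ b₂ ((annGlue b₁ b₂).connectedComponentMk s))
    (hO : ¬ MeetsOuter b₁ b₂ ((annGlue b₁ b₂).connectedComponentMk s)) :
    IsNullHomotopic b₁ b₂ ((annGlue b₁ b₂).connectedComponentMk s) ↔
      IsCurveOfClass m₁ m₂ ((mbGlue m₁ m₂).connectedComponentMk (retract e₁ e₂ s))
        (curveLoop .d) := by
  have hI' := hI
  have hO' := hO
  rw [meetsInner_mk_iff hm₁ hm₂ h₁ h₂] at hI'
  rw [meetsOuter_mk_iff hm₁ hm₂ h₁ h₂] at hO'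
  have hcover : ∀ v, (m₁.oppPair m₂).Orbit (retract e₁ e₂ s) v → ∀ k : ℤ,
      (annGlueCover b₁ b₂).Reachable (0, Sum.inl v) (k, Sum.inl v) ↔
        ∃ j : ℤ, k = j * closedWinding m₁ m₂ v := fun v hv =>
    annGlueCover_reachable_iff hm₁ hm₂ h₁ h₂ (fun u hu h => hI' ⟨u, hu, hv.trans h⟩)
      (fun u hu h => hO' ⟨u, hu, hv.trans h⟩)
  have hlabel : ∀ v, (m₁.oppPair m₂).Orbit (retract e₁ e₂ s) v →
      (IsCurveOfClass m₁ m₂ ((mbGlue m₁ m₂).connectedComponentMk (retract e₁ e₂ s))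
        (curveLoop .d) ↔ closedWinding m₁ m₂ v = 0) := by
    intro v hv
    obtain ⟨t, ht, t₁, t₂, t₃⟩ := exists_label hm₁ hm₂ v
    have ht₁ : ¬ (t = .x ∨ t = .w) := fun h => by
      obtain ⟨u, hu, h⟩ := t₁.2 h
      exact hI' ⟨u, hu, hv.trans h⟩
    have ht₂ : ¬ (t = .y ∨ t = .w) := fun h => by
      obtain ⟨u, hu, h⟩ := t₂.2 h
      exact hO' ⟨u, hu, hv.trans h⟩
    rw [SimpleGraph.ConnectedComponent.sound ((mbGlue_reachable_iff m₁ m₂).2 hv),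
      ← t₃ (by cases t <;> simp_all)]
    exact ⟨fun h => isCurveOfClass_unique ht h, fun h => h ▸ ht⟩
  constructor
  · intro h
    rw [hlabel _ (MatchingPair.Orbit.refl _)]
    refine h (Sum.inl (retract e₁ e₂ s)) ?_ _ ((hcover _ (MatchingPair.Orbit.refl _) _).2
      ⟨1, (one_mul _).symm⟩)
    exact SimpleGraph.ConnectedComponent.sound (annGlue_reachable_retract h₁ h₂ s).symm
  · intro h v hv k hk
    rcases v with v | j | j
    · have hsv : (m₁.oppPair m₂).Orbit (retract e₁ e₂ s) v :=
        ((annGlue_reachable_iff h₁ h₂).1 (SimpleGraph.ConnectedComponent.exact hv)).orbit.symm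
      obtain ⟨j, rfl⟩ := (hcover v hsv k).1 hk
      rw [(hlabel v hsv).1 h, mul_zero]
    · exact absurd ⟨j, hv⟩ hI
    · exact absurd ⟨j, hv⟩ hO

theorem hasLabel_iff (hm₁ : IsMb0 m₁ ∨ IsMb1 m₁) (hm₂ : IsMb0 m₂ ∨ IsMb1 m₂)
    (h₁ : IsCut m₁ b₁ e₁) (h₂ : IsCut m₂ b₂ e₂)
    (C : (annGlue b₁ b₂).ConnectedComponent) (t : CurveVar) :
    HasLabel b₁ b₂ C t ↔ IsCurveOfClass m₁ m₂ (project h₁ h₂ C) (curveLoop t) := by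
  induction C using SimpleGraph.ConnectedComponent.ind with | _ s
  obtain ⟨t₀, ht₀, t₁, t₂, -⟩ := exists_label hm₁ hm₂ (retract e₁ e₂ s)
  have hiff : IsCurveOfClass m₁ m₂ (project h₁ h₂ ((annGlue b₁ b₂).connectedComponentMk s))
      (curveLoop t) ↔ t₀ = t :=
    ⟨fun h => isCurveOfClass_unique ht₀ h, fun h => h ▸ ht₀⟩
  have hnull := isNullHomotopic_iff (s := s) hm₁ hm₂ h₁ h₂
  rw [meetsInner_mk_iff hm₁ hm₂ h₁ h₂, meetsOuter_mk_iff hm₁ hm₂ h₁ h₂, t₁, t₂] at hnull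
  have hd : IsCurveOfClass m₁ m₂ ((mbGlue m₁ m₂).connectedComponentMk (retract e₁ e₂ s))
      (curveLoop .d) ↔ t₀ = .d :=
    ⟨fun h => isCurveOfClass_unique ht₀ h, fun h => h ▸ ht₀⟩
  rw [hd] at hnull
  rw [hiff]
  cases t <;> simp only [HasLabel, IsClosedCurve, meetsInner_mk_iff hm₁ hm₂ h₁ h₂,
    meetsOuter_mk_iff hm₁ hm₂ h₁ h₂, t₁, t₂] <;> cases t₀ <;> simp_all

/-- A curve that does not run through both crosscaps yields one curve or arc in the glued annulus. -/
theorem card_hasLabel (hm₁ : IsMb0 m₁ ∨ IsMb1 m₁) (hm₂ : IsMb0 m₂ ∨ IsMb1 m₂)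
    (h₁ : IsCut m₁ b₁ e₁) (h₂ : IsCut m₂ b₂ e₂)
    {t : CurveVar} (ht : t ≠ .w) :
    Nat.card {C // HasLabel b₁ b₂ C t} = mbCount m₁ m₂ (curveLoop t) := by
  refine Nat.card_congr (Equiv.ofBijective
    (fun C => ⟨project h₁ h₂ C.1, (hasLabel_iff hm₁ hm₂ h₁ h₂ C.1 t).1 C.2⟩) ⟨?_, ?_⟩)
  · rintro ⟨C, hC⟩ ⟨C', hC'⟩ heq
    have heq' := congrArg Subtype.val heq
    rw [hasLabel_iff hm₁ hm₂ h₁ h₂] at hC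
    simp only at heq'
    apply Subtype.ext
    simp only
    induction C using SimpleGraph.ConnectedComponent.ind with | _ s
    induction C' using SimpleGraph.ConnectedComponent.ind with | _ s'
    rw [project_mk, project_mk, SimpleGraph.ConnectedComponent.eq, mbGlue_reachable_iff] at heq'
    rw [SimpleGraph.ConnectedComponent.eq, annGlue_reachable_iff h₁ h₂]
    obtain ⟨t₀, ht₀, t₁, t₂, -⟩ := exists_label hm₁ hm₂ (retract e₁ e₂ s)
    obtain rfl := isCurveOfClass_unique ht₀ hC
    by_cases hx : t₀ = .x
    · refine MatchingPair.linked_of_disjoint_right (isArcEnds_crossing hm₁) heq' fun z hz hzm => ?_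
      have := t₂.1 ⟨z, hzm, hz⟩
      subst hx
      simp at this
    · refine MatchingPair.linked_of_disjoint_left (isArcEnds_crossing hm₂) heq' fun z hz hzm => ?_
      exact (t₁.1 ⟨z, hzm, hz⟩).elim hx ht
  · rintro ⟨D, hD⟩
    induction D using SimpleGraph.ConnectedComponent.ind with | _ v
    exact ⟨⟨(annGlue b₁ b₂).connectedComponentMk (Sum.inl v),
      (hasLabel_iff hm₁ hm₂ h₁ h₂ _ t).2 hD⟩, rfl⟩

/-- A curve that runs through both crosscaps yields a pair of arcs in the glued annulus. -/
theorem card_hasLabel_w (hm₁ : IsMb0 m₁ ∨ IsMb1 m₁) (hm₂ : IsMb0 m₂ ∨ IsMb1 m₂)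
    (h₁ : IsCut m₁ b₁ e₁) (h₂ : IsCut m₂ b₂ e₂) :
    Nat.card {C // HasLabel b₁ b₂ C .w} / 2 = mbCount m₁ m₂ (curveLoop .w) := by
  have hA := isArcEnds_crossing hm₁
  have hB := isArcEnds_crossing hm₂
  have hmeet : ∀ v, IsCurveOfClass m₁ m₂ ((mbGlue m₁ m₂).connectedComponentMk v) (curveLoop .w) →
      (∃ u ∈ crossing m₁, (m₁.oppPair m₂).Orbit v u) ∧
        ∃ u ∈ crossing m₂, (m₁.oppPair m₂).Orbit v u := by
    intro v hv
    obtain ⟨t₀, ht₀, t₁, t₂, -⟩ := exists_label hm₁ hm₂ v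
    obtain rfl := isCurveOfClass_unique ht₀ hv
    exact ⟨t₁.2 (Or.inr rfl), t₂.2 (Or.inr rfl)⟩
  by_cases hex : ∃ D, IsCurveOfClass m₁ m₂ D (curveLoop .w)
  · obtain ⟨D, hD⟩ := hex
    induction D using SimpleGraph.ConnectedComponent.ind with | _ v
    obtain ⟨⟨l, hl, hvl⟩, b, hb, hvb⟩ := hmeet v hD
    have hlb := hvl.symm.trans hvb
    rw [SimpleGraph.ConnectedComponent.sound ((mbGlue_reachable_iff m₁ m₂).2 hvl)] at hD
    have horb : ∀ u, IsCurveOfClass m₁ m₂ ((mbGlue m₁ m₂).connectedComponentMk u) (curveLoop .w) →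
        (m₁.oppPair m₂).Orbit l u := by
      intro u hu
      obtain ⟨⟨l', hl', hul'⟩, -⟩ := hmeet u hu
      rcases hA.2 l hl l' hl' with rfl | rfl
      · exact hul'.symm
      · exact (MatchingPair.orbit_f (D := m₁.oppPair m₂) l).trans hul'.symm
    have hM : mbCount m₁ m₂ (curveLoop .w) = 1 := by
      rw [mbCount, Nat.card_eq_one_iff_unique]
      refine ⟨⟨?_⟩, ⟨⟨_, hD⟩⟩⟩
      have : ∀ D, IsCurveOfClass m₁ m₂ D (curveLoop .w) →
          D = (mbGlue m₁ m₂).connectedComponentMk l := by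
        intro D hD
        induction D using SimpleGraph.ConnectedComponent.ind with | _ u
        exact SimpleGraph.ConnectedComponent.sound ((mbGlue_reachable_iff m₁ m₂).2 (horb u hD).symm)
      rintro ⟨D, hD⟩ ⟨D', hD'⟩
      exact Subtype.ext ((this D hD).trans (this D' hD').symm)
    have hset : {C | HasLabel b₁ b₂ C .w} =
        {(annGlue b₁ b₂).connectedComponentMk (Sum.inl l),
          (annGlue b₁ b₂).connectedComponentMk (Sum.inl (m₁.opp l))} := by
      ext C
      rw [Set.mem_ofPred_eq, hasLabel_iff hm₁ hm₂ h₁ h₂]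
      constructor
      · intro hC
        induction C using SimpleGraph.ConnectedComponent.ind with | _ s
        rw [project_mk] at hC
        rcases MatchingPair.linked_or_linked_f hA hB hl hb hlb (horb _ hC) with h | h
        · exact Or.inl (SimpleGraph.ConnectedComponent.sound
            ((annGlue_reachable_iff h₁ h₂).2 h.symm))
        · exact Or.inr (SimpleGraph.ConnectedComponent.sound
            ((annGlue_reachable_iff h₁ h₂).2 h.symm))
      · rintro (rfl | rfl)
        · exact hD
        · rw [SimpleGraph.ConnectedComponent.sound ((mbGlue_reachable_iff m₁ m₂).2
            (MatchingPair.orbit_f (D := m₁.oppPair m₂) l))] at hD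
          exact hD
    have hN : Nat.card {C // HasLabel b₁ b₂ C .w} = 2 := by
      change Set.ncard {C | HasLabel b₁ b₂ C .w} = 2
      rw [hset]
      refine Set.ncard_pair fun h => ?_
      have h' := (annGlue_reachable_iff h₁ h₂).1 (SimpleGraph.ConnectedComponent.exact h)
      exact (MatchingPair.linked_split hA hB hl hb hlb).1 h'
    rw [hM, hN]
  · push Not at hex
    have hM : IsEmpty {D // IsCurveOfClass m₁ m₂ D (curveLoop .w)} := ⟨fun D => hex D.1 D.2⟩
    have hN : IsEmpty {C // HasLabel b₁ b₂ C .w} :=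
      ⟨fun C => hex _ ((hasLabel_iff hm₁ hm₂ h₁ h₂ C.1 .w).1 C.2)⟩
    rw [mbCount, Nat.card_of_isEmpty, Nat.card_of_isEmpty]

theorem annForm_eq_mbForm (hm₁ : IsMb0 m₁ ∨ IsMb1 m₁) (hm₂ : IsMb0 m₂ ∨ IsMb1 m₂)
    (h₁ : IsCut m₁ b₁ e₁) (h₂ : IsCut m₂ b₂ e₂) : annForm b₁ b₂ = mbForm m₁ m₂ := by
  have hd := card_hasLabel hm₁ hm₂ h₁ h₂ (t := .d) (by simp)
  have hx := card_hasLabel hm₁ hm₂ h₁ h₂ (t := .x) (by simp)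
  have hy := card_hasLabel hm₁ hm₂ h₁ h₂ (t := .y) (by simp)
  have hz := card_hasLabel hm₁ hm₂ h₁ h₂ (t := .z) (by simp)
  have hw := card_hasLabel_w hm₁ hm₂ h₁ h₂
  simp only [HasLabel, curveLoop] at hd hx hy hz hw
  rw [annForm, mbForm, hd, hx, hy, hz, hw]

end Count

/-! ### Replacing the crosscap by an inner boundary -/

section Positions

variable {N p : ℕ}

theorem annPos_inl_lt_inl {k k' : ℤ} {l l' : Fin N} :
    annPos N p (k, Sum.inl l) < annPos N p (k', Sum.inl l') ↔
      k < k' ∨ k = k' ∧ (l : ℕ) < l' := by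
  simp [annPos, Prod.Lex.toLex_lt_toLex]

theorem annPos_inl_lt_inr {k k' : ℤ} {l : Fin N} {j : Fin p} :
    annPos N p (k, Sum.inl l) < annPos N p (k', Sum.inr j) ↔ True := by
  simp [annPos, Prod.Lex.toLex_lt_toLex]

theorem annPos_inr_lt_inl {k k' : ℤ} {l : Fin N} {j : Fin p} :
    annPos N p (k, Sum.inr j) < annPos N p (k', Sum.inl l) ↔ False := by
  simp [annPos, Prod.Lex.toLex_lt_toLex]

theorem annPos_inr_lt_inr {k k' : ℤ} {j j' : Fin p} :
    annPos N p (k, Sum.inr j) < annPos N p (k', Sum.inr j') ↔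
      k' < k ∨ k = k' ∧ (j' : ℕ) < j := by
  simp [annPos, Prod.Lex.toLex_lt_toLex]

end Positions

variable {n p : ℕ}

theorem IsCut.shift_end {m : MbDiagram n} {b : AnnDiagram n p} {e : Fin p → Fin (2 * n)}
    (h : IsCut m b e) (j : Fin p) : b.shift (Sum.inl (e j)) = 0 := by
  rw [← h.opp_inr, b.shift_opp, h.shift_inr, neg_zero]

theorem IsCut.crossing_eq {m : MbDiagram n} {b : AnnDiagram n p} {e : Fin p → Fin (2 * n)}
    (h : IsCut m b e) : crossing m = Set.range e := by
  ext l
  exact ⟨h.exists_eq l, by rintro ⟨j, rfl⟩; exact h.mem_crossing j⟩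

theorem IsCut.sameOuterArcs {m : MbDiagram n} {b : AnnDiagram n p} {e : Fin p → Fin (2 * n)}
    (h : IsCut m b e) : SameOuterArcs m b := by
  intro k k' l l'
  rw [b.mate_mk, m.mate_mk]
  by_cases hl : l ∈ crossing m
  · have hs : Odd (m.shift l) := hl
    obtain ⟨j, rfl⟩ := h.exists_eq l hl
    rw [h.opp_end]
    simp only [Prod.mk.injEq, reduceCtorEq, and_false, false_iff, not_and]
    intro h'
    rw [Int.odd_iff] at hs
    omega
  · have hs := h.shift_inl l hl
    rw [h.opp_inl l hl]
    simp only [Prod.mk.injEq, Sum.inl.injEq]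
    constructor <;> rintro ⟨h1, h2⟩ <;> exact ⟨by omega, h2⟩

theorem IsCut.ann_unique {m : MbDiagram n} {b b' : AnnDiagram n p} {e : Fin p → Fin (2 * n)}
    (h : IsCut m b e) (h' : IsCut m b' e) : b = b' := by
  apply Connection.ext_shift_opp
  · rintro (l | j)
    · by_cases hl : l ∈ crossing m
      · obtain ⟨j, rfl⟩ := h.exists_eq l hl
        rw [h.shift_end, h'.shift_end]
      · have h1 := h.shift_inl l hl
        have h2 := h'.shift_inl l hl
        omega
    · rw [h.shift_inr, h'.shift_inr]
  · rintro (l | j)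
    · by_cases hl : l ∈ crossing m
      · obtain ⟨j, rfl⟩ := h.exists_eq l hl
        rw [h.opp_end, h'.opp_end]
      · rw [h.opp_inl l hl, h'.opp_inl l hl]
    · rw [h.opp_inr, h'.opp_inr]

theorem IsCut.mb_unique {m m' : MbDiagram n} (hm : IsMb0 m ∨ IsMb1 m) {b : AnnDiagram n p}
    {e : Fin p → Fin (2 * n)} (h : IsCut m b e) (h' : IsCut m' b e) : m = m' := by
  have hcross : crossing m = crossing m' := h.crossing_eq.trans h'.crossing_eq.symm
  have hopp : ∀ l, m.opp l = m'.opp l := by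
    intro l
    by_cases hl : l ∈ crossing m
    · have hl' : m'.opp l ∈ crossing m := by
        rw [hcross] at hl ⊢
        exact opp_mem_crossing hl
      rcases (isArcEnds_crossing hm).2 l hl _ hl' with e | e
      · exact absurd e (m'.opp_ne l)
      · exact e.symm
    · have h1 := h.opp_inl l hl
      rw [h'.opp_inl l (hcross ▸ hl)] at h1
      exact (Sum.inl_injective h1).symm
  apply Connection.ext_shift_opp _ hopp
  intro l
  by_cases hl : l ∈ crossing m
  · have h1 := shift_of_mem_crossing m hl
    have h2 := shift_of_mem_crossing m' (hcross ▸ hl)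
    rw [← hopp] at h2
    omega
  · rw [← h.shift_inl l hl, h'.shift_inl l (hcross ▸ hl)]

/-- The crosscap is replaced by an inner boundary. The two ends of the arc that intersects the crosscap
are joined to the inner marked points in their order, since the two new arcs would intersect each
other otherwise. -/
theorem exists_ann_isCut {m : MbDiagram n} {e : Fin p → Fin (2 * n)} (he : StrictMono e)
    (hcross : crossing m = Set.range e) : ∃ b : AnnDiagram n p, IsCut m b e := by
  have hex : ∀ l, ∃ o : Fin (2 * n) ⊕ Fin p, (l ∉ crossing m ∧ o = Sum.inl (m.opp l)) ∨
      ∃ j, e j = l ∧ o = Sum.inr j := by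
    intro l
    by_cases hl : l ∈ crossing m
    · rw [hcross] at hl
      obtain ⟨j, rfl⟩ := hl
      exact ⟨Sum.inr j, Or.inr ⟨j, rfl, rfl⟩⟩
    · exact ⟨_, Or.inl ⟨hl, rfl⟩⟩
  choose o ho using hex
  have he_mem : ∀ j, e j ∈ crossing m := fun j => hcross ▸ Set.mem_range_self j
  have ho_inl : ∀ l ∉ crossing m, o l = Sum.inl (m.opp l) := by
    intro l hl
    rcases ho l with ⟨-, h⟩ | ⟨j, rfl, -⟩
    · exact h
    · exact absurd (he_mem j) hl
  have ho_end : ∀ j, o (e j) = Sum.inr j := by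
    intro j
    rcases ho (e j) with ⟨h, -⟩ | ⟨j', h, h'⟩
    · exact absurd (he_mem j) h
    · rw [h', he.injective h]
  have hs_end : ∀ j, closeShift false (m.shift (e j)) = 0 := by
    intro j
    rcases shift_mod_two m (e j) with ⟨-, h⟩ | ⟨h, -⟩
    · exact closeShift_false_odd h
    · exact absurd (he_mem j) h
  have hs_inl : ∀ l ∉ crossing m, 2 * closeShift false (m.shift l) = m.shift l := by
    intro l hl
    rcases shift_mod_two m l with ⟨h, -⟩ | ⟨-, h⟩
    · exact absurd h hl
    · exact closeShift_even false h
  have hopp_not : ∀ l ∉ crossing m, m.opp l ∉ crossing m := fun l hl h =>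
    hl (m.opp_opp l ▸ opp_mem_crossing h)
  have hcases : ∀ l, l ∉ crossing m ∨ ∃ j, l = e j := by
    intro l
    by_cases hl : l ∈ crossing m
    · rw [hcross] at hl
      obtain ⟨j, rfl⟩ := hl
      exact Or.inr ⟨j, rfl⟩
    · exact Or.inl hl
  refine ⟨Connection.ofShift (Sum.elim o fun j => Sum.inl (e j))
    (Sum.elim (fun l => closeShift false (m.shift l)) fun _ => 0) ?_ ?_ ?_ ?_,
    fun l hl => ho_inl l hl, fun l hl => ?_, fun j => rfl, fun j => rfl, he_mem,
    fun l hl => by rwa [hcross] at hl⟩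
  · rintro (l | j)
    · rcases hcases l with hl | ⟨j, rfl⟩
      · simp only [Sum.elim_inl, ho_inl l hl, ho_inl _ (hopp_not l hl), m.opp_opp]
      · simp only [Sum.elim_inl, ho_end, Sum.elim_inr]
    · simp only [Sum.elim_inl, ho_end, Sum.elim_inr]
  · rintro (l | j)
    · rcases hcases l with hl | ⟨j, rfl⟩
      · simp only [Sum.elim_inl, ho_inl l hl]
        have h1 := hs_inl _ hl
        have h2 := hs_inl _ (hopp_not l hl)
        rw [m.shift_opp] at h2 ⊢
        omega
      · simp only [Sum.elim_inl, ho_end, Sum.elim_inr, hs_end, neg_zero]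
    · simp only [Sum.elim_inl, Sum.elim_inr, hs_end, neg_zero]
  · rintro (l | j)
    · rcases hcases l with hl | ⟨j, rfl⟩
      · simp only [Sum.elim_inl, ho_inl l hl]
        exact fun h => m.opp_ne l (Sum.inl_injective h)
      · simp [ho_end]
    · simp
  · rintro k k' (l | j) (l' | j') ⟨c1, c2, c3⟩
    · rcases hcases l with hl | ⟨j, rfl⟩ <;> rcases hcases l' with hl' | ⟨j', rfl⟩
      · simp only [Sum.elim_inl, ho_inl l hl, ho_inl l' hl', annPos_inl_lt_inl] at c1 c2 c3
        have h1 := hs_inl _ hl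
        have h2 := hs_inl _ hl'
        have h := m.noncrossing (2 * k, l) (2 * k', l')
        simp only [m.mate_mk, mbPos_lt_iff] at h
        omega
      · simp only [Sum.elim_inl, ho_inl l hl, annPos_inl_lt_inl] at c1 c2
        have h1 := hs_inl _ hl
        have h2 : m.shift (e j') % 2 = 1 := Int.odd_iff.1 (he_mem j')
        have h := m.noncrossing (2 * k, l) (2 * k', e j')
        simp only [m.mate_mk, mbPos_lt_iff] at h
        omega
      · simp only [Sum.elim_inl, ho_end, ho_inl l' hl', annPos_inr_lt_inl] at c3
      · simp only [Sum.elim_inl, ho_end, hs_end, annPos_inl_lt_inl, annPos_inr_lt_inr] at c1 c3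
        have h := he.lt_iff_lt (a := j) (b := j')
        simp only [Fin.lt_def] at h
        omega
    · rcases hcases l with hl | ⟨j, rfl⟩
      · simp only [Sum.elim_inl, ho_inl l hl, annPos_inr_lt_inl] at c2
      · simp only [Sum.elim_inl, Sum.elim_inr, ho_end, annPos_inr_lt_inl] at c3
    · simp only [annPos_inr_lt_inl] at c1
    · simp only [Sum.elim_inr, annPos_inr_lt_inl] at c2
  · change 2 * (0 + closeShift false (m.shift l)) = _
    rw [zero_add, hs_inl l hl]

/-- The ends of the arc through the crosscap are the outer marked points that are joined to inner
marked points. Here `r` exchanges the two inner marked points, and `σ` is the shift of the arc. -/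
theorem exists_mb_isCut {b : AnnDiagram n p} {e : Fin p → Fin (2 * n)}
    (he : ∀ j, b.opp (Sum.inr j) = Sum.inl (e j)) (hs : ∀ j, b.shift (Sum.inr j) = 0)
    (r : Fin p → Fin p) (σ : Fin p → ℤ) (hr : ∀ j, r (r j) = j) (hr_ne : ∀ j, r j ≠ j)
    (hσr : ∀ j, σ (r j) = -σ j) (hall : ∀ j j', j' = j ∨ j' = r j)
    (hσ : ∀ j, (σ j = -1 ∧ (e j : ℕ) < e (r j)) ∨ (σ j = 1 ∧ (e (r j) : ℕ) < e j)) :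
    ∃ m : MbDiagram n, IsCut m b e := by
  have hb_end : ∀ j, b.opp (Sum.inl (e j)) = Sum.inr j := fun j => by rw [← he, b.opp_opp]
  have hbs_end : ∀ j, b.shift (Sum.inl (e j)) = 0 := fun j => by
    rw [← he, b.shift_opp, hs, neg_zero]
  have he_inj : Function.Injective e := fun j j' h => by
    have := hb_end j
    rw [h, hb_end] at this
    exact (Sum.inr_injective this).symm
  have hex : ∀ l, ∃ (o : Fin (2 * n)) (s : ℤ),
      (b.opp (Sum.inl l) = Sum.inl o ∧ s = 2 * b.shift (Sum.inl l)) ∨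
        ∃ j, l = e j ∧ o = e (r j) ∧ s = σ j := by
    intro l
    rcases h : b.opp (Sum.inl l) with o | j
    · exact ⟨o, _, Or.inl ⟨rfl, rfl⟩⟩
    · refine ⟨e (r j), σ j, Or.inr ⟨j, ?_, rfl, rfl⟩⟩
      have := b.opp_opp (Sum.inl l)
      rw [h, he] at this
      exact (Sum.inl_injective this).symm
  choose o s hos using hex
  have ho_end : ∀ j, o (e j) = e (r j) ∧ s (e j) = σ j := by
    intro j
    rcases hos (e j) with ⟨h, -⟩ | ⟨j', h, h', h''⟩
    · rw [hb_end] at h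
      exact absurd h Sum.inr_ne_inl
    · rw [he_inj h]
      rw [← he_inj h] at h' h'' ⊢
      exact ⟨h', h''⟩
  have hcases : ∀ l, (b.opp (Sum.inl l) = Sum.inl (o l) ∧ s l = 2 * b.shift (Sum.inl l)) ∨
      ∃ j, l = e j := by
    intro l
    rcases hos l with h | ⟨j, h, -⟩
    · exact Or.inl h
    · exact Or.inr ⟨j, h⟩
  have hback : ∀ l, b.opp (Sum.inl l) = Sum.inl (o l) →
      b.opp (Sum.inl (o l)) = Sum.inl l := fun l h => by rw [← h, b.opp_opp]
  have hopp_opp : ∀ l, o (o l) = l ∧ s (o l) = -s l := by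
    intro l
    rcases hcases l with ⟨h1, h2⟩ | ⟨j, rfl⟩
    · rcases hcases (o l) with ⟨h1', h2'⟩ | ⟨j, h⟩
      · rw [hback l h1] at h1'
        refine ⟨(Sum.inl_injective h1').symm, ?_⟩
        rw [h2', h2, ← h1, b.shift_opp]
        ring
      · have := hback l h1
        rw [h, hb_end] at this
        exact absurd this Sum.inr_ne_inl
    · rw [(ho_end j).1, (ho_end j).2, (ho_end (r j)).1, (ho_end (r j)).2, hr, hσr]
      exact ⟨rfl, rfl⟩
  have hodd : ∀ j, s (e j) % 2 = 1 := fun j => by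
    rw [(ho_end j).2]
    have := hσ j
    omega
  have hmb : ∀ (k k' : ℤ) (l l' : Fin (2 * n)), ¬ (mbPos (2 * n) (k, l) < mbPos (2 * n) (k', l') ∧
      mbPos (2 * n) (k', l') < mbPos (2 * n) (k + s l, o l) ∧
      mbPos (2 * n) (k + s l, o l) < mbPos (2 * n) (k' + s l', o l')) := by
    rintro k k' l l' ⟨c1, c2, c3⟩
    rw [mbPos_lt_iff] at c1 c2 c3
    rcases hcases l with ⟨h1, h2⟩ | ⟨j, rfl⟩ <;> rcases hcases l' with ⟨h1', h2'⟩ | ⟨j', rfl⟩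
    · rcases Int.emod_two_eq_zero_or_one k with hk | hk
      · have h := b.noncrossing (k / 2, Sum.inl l) (k' / 2, Sum.inl l')
        simp only [b.mate_mk, h1, h1', annPos_inl_lt_inl] at h
        omega
      · -- on the second side of the strip the order is reversed
        have h := b.noncrossing ((k' + s l') / 2, Sum.inl (o l')) ((k + s l) / 2, Sum.inl (o l))
        have t1 := b.shift_opp (Sum.inl l)
        have t2 := b.shift_opp (Sum.inl l')
        rw [h1] at t1
        rw [h1'] at t2
        simp only [b.mate_mk, hback l h1, hback l' h1', t1, t2, annPos_inl_lt_inl] at h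
        omega
    · have hs' := hodd j'
      have h := b.noncrossing (k / 2, Sum.inl l) (k' / 2, Sum.inl (e j'))
      simp only [b.mate_mk, h1, hb_end, annPos_inl_lt_inl, annPos_inl_lt_inr, and_true] at h
      omega
    · have hs' := hodd j
      have h := b.noncrossing ((k' + s l') / 2, Sum.inl (o l')) ((k + s (e j)) / 2, Sum.inl (o (e j)))
      have t2 := b.shift_opp (Sum.inl l')
      rw [h1'] at t2
      rw [(ho_end j).1] at h c2 c3
      simp only [b.mate_mk, hb_end, hback l' h1', t2, annPos_inl_lt_inl, annPos_inl_lt_inr,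
        and_true] at h
      omega
    · rw [(ho_end j).1, (ho_end j).2] at c2 c3
      rw [(ho_end j').1, (ho_end j').2] at c3
      have hσj := hσ j
      rcases hall j j' with rfl | rfl
      · omega
      · rw [hσr, hr] at c3
        omega
  refine ⟨Connection.ofShift o s (fun l => (hopp_opp l).1) (fun l => (hopp_opp l).2) ?_ hmb, ?_⟩
  · intro l h
    rcases hcases l with ⟨h1, -⟩ | ⟨j, rfl⟩
    · rw [h] at h1
      exact b.opp_ne _ h1
    · rw [(ho_end j).1] at h
      exact hr_ne j (he_inj h)
  · set m : MbDiagram n := Connection.ofShift o s (fun l => (hopp_opp l).1)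
      (fun l => (hopp_opp l).2) _ hmb with hm
    have hms : ∀ l, m.shift l = s l := fun l => zero_add _
    have hmem : ∀ j, e j ∈ crossing m := fun j => by
      change Odd _
      rw [hms, Int.odd_iff]
      exact hodd j
    have hnot : ∀ l ∉ crossing m,
        b.opp (Sum.inl l) = Sum.inl (o l) ∧ s l = 2 * b.shift (Sum.inl l) := by
      intro l hl
      rcases hcases l with h | ⟨j, rfl⟩
      · exact h
      · exact absurd (hmem j) hl
    refine ⟨fun l hl => (hnot l hl).1, fun l hl => ?_, he, hs, hmem, fun l hl => ?_⟩
    · rw [hms, (hnot l hl).2]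
    · rcases hcases l with ⟨-, h⟩ | ⟨j, rfl⟩
      · have hl' : Odd (m.shift l) := hl
        rw [hms, h, Int.odd_iff] at hl'
        omega
      · exact ⟨j, rfl⟩

/-! ### The bijection and the determinants -/

section Bijection

variable {n : ℕ}

theorem sameOuterArcs_iff_isCut_zero {m : MbDiagram n} (b : AnnDiagram n 0) :
    SameOuterArcs m b ↔ IsCut m b Fin.elim0 := by
  refine ⟨fun h => ?_, IsCut.sameOuterArcs⟩
  obtain ⟨e, he⟩ := exists_isCut h fun j => j.elim0
  rwa [Subsingleton.elim e Fin.elim0] at he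

/-- The two arcs that end on the inner boundary do not intersect each other. -/
theorem strictMono_of_inner {b : AnnDiagram n 2} {e : Fin 2 → Fin (2 * n)}
    (he : ∀ j, b.opp (Sum.inr j) = Sum.inl (e j)) (hs : ∀ j, b.shift (Sum.inr j) = 0) :
    e 0 < e 1 := by
  have hmate : ∀ j, b.mate (0, Sum.inl (e j)) = (0, Sum.inr j) := fun j => by
    rw [← he, b.mate_mk, b.opp_opp, b.shift_opp, hs]
    rfl
  have hne : e 0 ≠ e 1 := fun h => by
    have h0 := hmate 0
    rw [h, hmate 1] at h0
    exact absurd h0 (by simp)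
  refine lt_of_le_of_ne (not_lt.1 fun hlt => ?_) hne
  refine b.noncrossing (0, Sum.inl (e 1)) (0, Sum.inl (e 0)) ?_
  rw [hmate, hmate, annPos_inl_lt_inl, annPos_inl_lt_inr, annPos_inr_lt_inr]
  exact ⟨Or.inr ⟨rfl, hlt⟩, trivial, Or.inr ⟨rfl, by decide⟩⟩

theorem isMb1_of_isCut {m : MbDiagram n} {b : AnnDiagram n 2} {e : Fin 2 → Fin (2 * n)}
    (h : IsCut m b e) : IsMb1 m := by
  have hlt := strictMono_of_inner h.opp_inr h.shift_inr
  rw [IsMb1, crosscapEnds_eq, h.crossing_eq, show Set.range e = {e 0, e 1} by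
    ext x; simp [Fin.exists_fin_two, eq_comm]]
  exact Set.ncard_pair hlt.ne

theorem isMb0_of_isCut {m : MbDiagram n} {b : AnnDiagram n 0} {e : Fin 0 → Fin (2 * n)}
    (h : IsCut m b e) : IsMb0 m := by
  rw [isMb0_iff, h.crossing_eq, Set.range_eq_empty]

theorem not_isMb0_and_isMb1 {m : MbDiagram n} (h₀ : IsMb0 m) (h₁ : IsMb1 m) : False := by
  rw [IsMb0] at h₀
  rw [IsMb1, h₀] at h₁
  omega

theorem existsUnique_isReplacement (m : MbOne n) : ∃! b, IsReplacement m b := by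
  obtain ⟨m, hm⟩ := m
  rcases id hm with h0 | h1
  · obtain ⟨b, hb⟩ := exists_ann_isCut (m := m) (e := Fin.elim0) (fun j => j.elim0)
      (by rw [isMb0_iff.1 h0, Set.range_eq_empty])
    refine ⟨Sum.inl b, ⟨h0, hb.sameOuterArcs⟩, ?_⟩
    rintro (b' | b') hb'
    · exact congrArg Sum.inl (((sameOuterArcs_iff_isCut_zero b').1 hb'.2).ann_unique hb)
    · exact (not_isMb0_and_isMb1 h0 hb'.1).elim
  · obtain ⟨l, hl, hlt⟩ : ∃ l ∈ crossing m, l < m.opp l := by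
      have hne : (crossing m).Nonempty := by
        refine Set.nonempty_of_ncard_ne_zero ?_
        rw [← crosscapEnds_eq, h1]
        exact two_ne_zero
      obtain ⟨l, hl⟩ := hne
      rcases shift_of_mem_crossing m hl with ⟨-, h⟩ | ⟨-, h⟩
      · exact ⟨l, hl, h⟩
      · exact ⟨m.opp l, opp_mem_crossing hl, by rwa [m.opp_opp]⟩
    have hcross := crossing_eq_pair hm hl
    obtain ⟨b, hb⟩ := exists_ann_isCut (m := m) (e := ![l, m.opp l])
      (by rw [Fin.strictMono_iff_lt_succ]; intro i; fin_cases i; exact hlt)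
      (by rw [hcross]; ext x; simp [eq_comm]; exact or_comm)
    refine ⟨Sum.inr ⟨b, fun j => ⟨![l, m.opp l] j, ?_⟩⟩, ⟨h1, hb.sameOuterArcs⟩, ?_⟩
    · rw [b.mate_mk, hb.opp_inr, hb.shift_inr, add_zero]
    · rintro (b' | b') hb'
      · exact (not_isMb0_and_isMb1 hb'.1 h1).elim
      · obtain ⟨e, he⟩ := exists_isCut hb'.2 b'.2
        have hlt' := strictMono_of_inner he.opp_inr he.shift_inr
        have c0 := he.mem_crossing 0
        have c1 := he.mem_crossing 1
        rw [hcross] at c0 c1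
        have hee : e = ![l, m.opp l] := by
          rcases c0 with c0 | c0 <;> rcases c1 with c1 | c1 <;> rw [c0, c1] at hlt'
          · exact absurd hlt' (lt_irrefl _)
          · ext j; fin_cases j
            · exact congrArg _ c0
            · exact congrArg _ c1
          · exact absurd hlt' hlt.asymm
          · exact absurd hlt' (lt_irrefl _)
        subst hee
        exact congrArg Sum.inr (Subtype.ext (he.ann_unique hb))

theorem exists_isReplacement_of_ann (b : BOne n) : ∃ m, IsReplacement m b := by
  rcases b with b | ⟨b, hb⟩
  · obtain ⟨m, hm⟩ := exists_mb_isCut (b := b) (e := Fin.elim0) (fun j => j.elim0)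
      (fun j => j.elim0) id (fun _ => 0) (fun j => j.elim0) (fun j => j.elim0) (fun j => j.elim0)
      (fun j => j.elim0) (fun j => j.elim0)
    exact ⟨⟨m, Or.inl (isMb0_of_isCut hm)⟩, isMb0_of_isCut hm, hm.sameOuterArcs⟩
  · have hb' := hb
    choose e he using hb'
    have he' : ∀ j, b.opp (Sum.inr j) = Sum.inl (e j) := fun j => congrArg Prod.snd (he j)
    have hs' : ∀ j, b.shift (Sum.inr j) = 0 := fun j => congrArg Prod.fst (he j)
    have hlt := strictMono_of_inner he' hs'
    obtain ⟨m, hm⟩ := exists_mb_isCut he' hs' Fin.rev ![-1, 1] Fin.rev_rev (by decide) (by decide)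
      (by decide) (fun j => by fin_cases j <;> [left; right] <;> exact ⟨rfl, hlt⟩)
    exact ⟨⟨m, Or.inr (isMb1_of_isCut hm)⟩, isMb1_of_isCut hm, hm.sameOuterArcs⟩

theorem isReplacement_injective {m m' : MbOne n} {b : BOne n} (h : IsReplacement m b)
    (h' : IsReplacement m' b) : m = m' := by
  apply Subtype.ext
  rcases b with b | ⟨b, hb⟩
  · exact ((sameOuterArcs_iff_isCut_zero b).1 h.2).mb_unique m.2
      ((sameOuterArcs_iff_isCut_zero b).1 h'.2)
  · obtain ⟨e, he⟩ := exists_isCut h.2 hb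
    obtain ⟨e', he'⟩ := exists_isCut h'.2 hb
    obtain rfl : e = e' := funext fun j =>
      Sum.inl_injective ((he.opp_inr j).symm.trans (he'.opp_inr j))
    exact he.mb_unique m.2 he'

theorem formB_eq_formMb {m₁ m₂ : MbOne n} {b₁ b₂ : BOne n} (h₁ : IsReplacement m₁ b₁)
    (h₂ : IsReplacement m₂ b₂) : formB b₁ b₂ = formMb m₁ m₂ := by
  rcases b₁ with b₁ | ⟨b₁, hb₁⟩ <;> rcases b₂ with b₂ | ⟨b₂, hb₂⟩
  · exact annForm_eq_mbForm m₁.2 m₂.2 ((sameOuterArcs_iff_isCut_zero b₁).1 h₁.2)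
      ((sameOuterArcs_iff_isCut_zero b₂).1 h₂.2)
  · obtain ⟨e₂, he₂⟩ := exists_isCut h₂.2 hb₂
    exact annForm_eq_mbForm m₁.2 m₂.2 ((sameOuterArcs_iff_isCut_zero b₁).1 h₁.2) he₂
  · obtain ⟨e₁, he₁⟩ := exists_isCut h₁.2 hb₁
    exact annForm_eq_mbForm m₁.2 m₂.2 he₁ ((sameOuterArcs_iff_isCut_zero b₂).1 h₂.2)
  · obtain ⟨e₁, he₁⟩ := exists_isCut h₁.2 hb₁
    obtain ⟨e₂, he₂⟩ := exists_isCut h₂.2 hb₂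
    exact annForm_eq_mbForm m₁.2 m₂.2 he₁ he₂

end Bijection

end SurfaceGram

theorem mainTheorem2 (n : ℕ) :
    ∃ φ : SurfaceGram.MbOne n → SurfaceGram.BOne n,
      (∀ m b, φ m = b ↔ SurfaceGram.IsReplacement m b) ∧
      Function.Bijective φ ∧
      (∀ m₁ m₂, SurfaceGram.formB (φ m₁) (φ m₂) = SurfaceGram.formMb m₁ m₂) ∧
      SurfaceGram.gramDetMb n = SurfaceGram.gramDetB n := by
  choose φ hφ huniq using fun m : SurfaceGram.MbOne n => SurfaceGram.existsUnique_isReplacement m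
  have hbij : Function.Bijective φ := by
    refine ⟨fun m m' h => SurfaceGram.isReplacement_injective (hφ m) (h ▸ hφ m'), fun b => ?_⟩
    obtain ⟨m, hm⟩ := SurfaceGram.exists_isReplacement_of_ann b
    exact ⟨m, (huniq m b hm).symm⟩
  have hform : ∀ m₁ m₂, SurfaceGram.formB (φ m₁) (φ m₂) = SurfaceGram.formMb m₁ m₂ :=
    fun m₁ m₂ => SurfaceGram.formB_eq_formMb (hφ m₁) (hφ m₂)
  refine ⟨φ, fun m b => ⟨fun h => h ▸ hφ m, fun h => (huniq m b h).symm⟩, hbij, hform, ?_⟩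
  have hM : SurfaceGram.gramMatrixMb n = (SurfaceGram.gramMatrixB n).submatrix
      (Equiv.ofBijective φ hbij) (Equiv.ofBijective φ hbij) := by
    ext1 m₁ m₂
    exact (hform m₁ m₂).symm
  classical
  rw [SurfaceGram.gramDetMb, SurfaceGram.gramDetB, hM]
  convert Matrix.det_submatrix_equiv_self (Equiv.ofBijective φ hbij) (SurfaceGram.gramMatrixB n)
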